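/- Let $(\mathcal X,\nu)$ and $(\mathcal Z,\mu)$ be $\sigma$-finite measure spaces, $T\in\mathbb N$, $N\ge 1$. Let $p$ be a sequential latent variable model $p(x_{1:T},z_{1:T})=\prod_{t=1}^T p_t(x_t,z_t\mid x_{1:t-1},z_{1:t-1})$, where the $p_t$ are measurable, finite-valued conditional densities with respect to $\nu\otimes\mu$. Write $p(x_{1:t})=\int p(x_{1:t},z_{1:t})\,dz_{1:t}$ (all integrals over latents are with respect to $\mu$), and let $p(z_{1:t}\mid x_{1:t})$ and $p(z_{1:t-1}\mid x_{1:t})$ be the corresponding posterior densities. A variational posterior is a product $q(z_{1:T}\mid x_{1:T})=\prod_{t=1}^T q_t(z_t\mid x_{1:t},z_{1:t-1})$ of measurable, finite-valued conditional densities with respect to $\mu$. Given $x_{1:T}$, $p$, $q$ and, for every $t$, a measurable set $C_t$ of weight vectors (the resampling criterion, which may be adaptive), the particle filter starts from $w_0^i=1/N$ $(1\le i\le N)$, $\hat p_N(x_{1:0})=1$, and for $t=1,\dots,T$: it draws $z_t^i\sim q_t(\cdot\mid x_{1:t},z_{1:t-1}^i)$ independently over $i$, puts $z_{1:t}^i=(z_{1:t-1}^i,z_t^i)$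 and $$\alpha_t(z_{1:t}^i)=\frac{p_t(x_t,z_t^i\mid x_{1:t-1},z_{1:t-1}^i)}{q_t(z_t^i\mid x_{1:t},z_{1:t-1}^i)},\qquad \hat p_t=\sum_{i=1}^N w_{t-1}^i\,\alpha_t(z_{1:t}^i),\qquad \hat p_N(x_{1:t})=\hat p_N(x_{1:t-1})\,\hat p_t,\qquad w_t^i=\frac{w_{t-1}^i\,\alpha_t(z_{1:t}^i)}{\hat p_t};$$ and if $(w_t^i)_{i}\in C_t$, it replaces the $N$ trajectories by $N$ independent draws from the categorical distribution on $\{z_{1:t}^i\}_i$ with probabilities $(w_t^i)_i$ and resets all weights to $1/N$. (If $\hat p_t=0$, the estimate is $0$ from then on, all weights are set to $0$ and nothing is resampled.) The filtering variational objective is $\mathrm{FIVO}_N(x_{1:T},p,q)=\mathbb E[\log\hat p_N(x_{1:T})]\in[-\infty,\infty]$. Fix an observation $x_{1:T}$ with $0<p(x_{1:T})<\infty$, and assume that $p(z_{1:t-1}\mid x_{1:t})=p(z_{1:t-1}\mid x_{1:t-1})$ for almost every $z_{1:t-1}$, for every $t\in\{2,\dots,T\}$. Then $q\mapsto\mathrm{FIVO}_N(x_{1:T},p,q)$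 attains its maximum over all variational posteriors; a variational posterior $q^*$ is a maximizer if and only if $$q^*(z_{1:T}\mid x_{1:T})=p(z_{1:T}\mid x_{1:T})\quad\text{for almost every }z_{1:T};$$ and every maximizer $q^*$ satisfies $\mathrm{FIVO}_N(x_{1:T},p,q^*)=\log p(x_{1:T})$. -/

import Mathlib

open MeasureTheory
open scoped ENNReal NNReal

noncomputable section

/-- A sequential latent variable model of horizon `T`, with densities with respect to reference
measures `ν` on the observation space `X` and `μ` on the latent space `Z`. Time is counted from
`0`: `dens t xs zs x z` is the conditional density of the observation-latent pair number `t`, at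
`(x, z)`, given the `t` previous observations `xs` and the `t` previous latents `zs`.
Only the indices `t < T` matter. -/
structure SequentialModel {X Z : Type*} [MeasurableSpace X] [MeasurableSpace Z]
    (ν : Measure X) (μ : Measure Z) (T : ℕ) where
  dens : (t : ℕ) → (Fin t → X) → (Fin t → Z) → X → Z → ℝ≥0
  measurable_dens : ∀ t < T, Measurable
    fun a : (Fin t → X) × (Fin t → Z) × X × Z => dens t a.1 a.2.1 a.2.2.1 a.2.2.2
  lintegral_dens : ∀ t < T, ∀ (xs : Fin t → X) (zs : Fin t → Z),
    ∫⁻ x, ∫⁻ z, (dens t xs zs x z : ℝ≥0∞) ∂μ ∂ν = 1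

/-- A variational posterior of horizon `T`, factored over time: `dens t xs zs z` is the density,
at `z`, of the latent number `t` given the `t + 1` observations `xs` up to and including the
current one and the `t` previous latents `zs`. Only the indices `t < T` matter. -/
structure Proposal (X : Type*) {Z : Type*} [MeasurableSpace X] [MeasurableSpace Z]
    (μ : Measure Z) (T : ℕ) where
  dens : (t : ℕ) → (Fin (t + 1) → X) → (Fin t → Z) → Z → ℝ≥0
  measurable_dens : ∀ t < T, Measurable
    fun a : (Fin (t + 1) → X) × (Fin t → Z) × Z => dens t a.1 a.2.1 a.2.2
  lintegral_dens : ∀ t < T, ∀ (xs : Fin (t + 1) → X) (zs : Fin t → Z),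
    ∫⁻ z, (dens t xs zs z : ℝ≥0∞) ∂μ = 1

section Densities

variable {X Z : Type*} [MeasurableSpace X] [MeasurableSpace Z]
  {ν : Measure X} {μ : Measure Z} {T : ℕ}

/-- The first `t` terms of an observation sequence. -/
def obs (x : ℕ → X) (t : ℕ) : Fin t → X := fun i => x i

/-- The first `s` latents of a latent trajectory of length `t`. -/
def latentPrefix {t : ℕ} (z : Fin t → Z) (s : Fin t) : Fin s → Z :=
  fun i => z (Fin.castLE s.isLt.le i)

/-- The trajectory `z` of length `t` followed by the latent `z'`. -/
def concat {t : ℕ} (z : Fin t → Z) (z' : Z) : Fin (t + 1) → Z :=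
  Fin.snoc (α := fun _ => Z) z z'

/-- The joint density of the first `t` observations and the first `t` latents. -/
def SequentialModel.joint (p : SequentialModel ν μ T) (x : ℕ → X) (t : ℕ)
    (z : Fin t → Z) : ℝ≥0 :=
  ∏ s : Fin t, p.dens s (obs x s) (latentPrefix z s) (x s) (z s)

/-- The marginal likelihood of the first `t` observations. -/
def SequentialModel.evidence (p : SequentialModel ν μ T) (x : ℕ → X) (t : ℕ) : ℝ≥0∞ :=
  ∫⁻ z, (p.joint x t z : ℝ≥0∞) ∂Measure.pi fun _ : Fin t => μ

/-- The posterior density of the first `t` latents given the first `t` observations. -/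
def SequentialModel.posterior (p : SequentialModel ν μ T) (x : ℕ → X) (t : ℕ)
    (z : Fin t → Z) : ℝ≥0∞ :=
  (p.joint x t z : ℝ≥0∞) / p.evidence x t

/-- The posterior density of the first `t` latents given the first `t + 1` observations. -/
def SequentialModel.lookaheadPosterior (p : SequentialModel ν μ T) (x : ℕ → X) (t : ℕ)
    (z : Fin t → Z) : ℝ≥0∞ :=
  (∫⁻ z', (p.joint x (t + 1) (concat z z') : ℝ≥0∞) ∂μ) / p.evidence x (t + 1)

/-- The joint density of the `T` latents under the variational posterior. -/
def Proposal.joint (q : Proposal X μ T) (x : ℕ → X) (z : Fin T → Z) : ℝ≥0 :=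
  ∏ t : Fin T, q.dens t (obs x (t + 1)) (latentPrefix z t) (z t)

/-- The incremental importance weight of a trajectory of length `t + 1`, given as its first `t`
latents `zs` and its last latent `z`. -/
def incrementalWeight (p : SequentialModel ν μ T) (q : Proposal X μ T) (x : ℕ → X) (t : ℕ)
    (zs : Fin t → Z) (z : Z) : ℝ≥0 :=
  p.dens t (obs x t) zs (x t) z / q.dens t (obs x (t + 1)) zs z

end Densities

/-- The state of a particle filter with `N` particles after `t` steps: the current estimate of the
marginal likelihood, the weights and the trajectories. -/
abbrev FilterState (Z : Type*) (N t : ℕ) : Type _ :=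
  ℝ≥0 × (Fin N → ℝ≥0) × (Fin N → Fin t → Z)

/-- The categorical distribution with the given probabilities. -/
def categorical {N : ℕ} (w : Fin N → ℝ≥0) : Measure (Fin N) :=
  ∑ i, (w i : ℝ≥0∞) • Measure.dirac i

section Filter

variable {X Z : Type*} [MeasurableSpace X] [MeasurableSpace Z]
  {ν : Measure X} {μ : Measure Z} {T N : ℕ}

/-- The joint law of the `N` new latents, proposed independently, each from the trajectory of its
particle. -/
def proposalLaw (q : Proposal X μ T) (x : ℕ → X) (t : ℕ) (zs : Fin N → Fin t → Z) :
    Measure (Fin N → Z) :=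
  Measure.pi fun i => μ.withDensity fun z => (q.dens t (obs x (t + 1)) (zs i) z : ℝ≥0∞)

/-- Extends the trajectories by the proposed latents, multiplies the likelihood estimate by the
weighted average of the incremental weights, and updates and normalizes the weights. -/
def reweight (p : SequentialModel ν μ T) (q : Proposal X μ T) (x : ℕ → X) (t : ℕ)
    (s : FilterState Z N t) (z : Fin N → Z) : FilterState Z N (t + 1) :=
  let v : Fin N → ℝ≥0 := fun i => s.2.1 i * incrementalWeight p q x t (s.2.2 i) (z i)
  (s.1 * ∑ i, v i, fun i => v i / ∑ j, v j, fun i => concat (s.2.2 i) (z i))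

open Classical in
/-- If the weights satisfy the resampling criterion `C`, draws `N` ancestors independently in
proportion to the weights, and resets the weights to `1 / N`; otherwise changes nothing.
The weights vanish simultaneously exactly when the current likelihood increment is zero; the
likelihood estimate is then zero and remains so, and nothing is resampled. -/
def resample {t : ℕ} (C : Set (Fin N → ℝ≥0)) (s : FilterState Z N t) :
    Measure (FilterState Z N t) :=
  if s.2.1 ∈ C ∧ ∑ i, s.2.1 i ≠ 0 then
    (Measure.pi fun _ : Fin N => categorical s.2.1).map
      fun a : Fin N → Fin N => (s.1, fun _ => (N : ℝ≥0)⁻¹, fun i => s.2.2 (a i))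
  else Measure.dirac s

/-- The law of the state of the particle filter after `t` steps, where `C t` is the resampling
criterion (a set of weight vectors) in force at step `t`. -/
def filterLaw (C : ℕ → Set (Fin N → ℝ≥0)) (p : SequentialModel ν μ T) (q : Proposal X μ T)
    (x : ℕ → X) : (t : ℕ) → Measure (FilterState Z N t)
  | 0 => Measure.dirac (1, fun _ => (N : ℝ≥0)⁻¹, fun _ => Fin.elim0)
  | t + 1 => (filterLaw C p q x t).bind fun s =>
      (proposalLaw q x t s.2.2).bind fun z => resample (C t) (reweight p q x t s z)

end Filter

/-- The expectation of an extended real random variable, as the expectation of its positive part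
minus that of its negative part. -/
def extendedExpectation {Ω : Type*} [MeasurableSpace Ω] (P : Measure Ω) (f : Ω → EReal) : EReal :=
  ((∫⁻ ω, (f ω).toENNReal ∂P : ℝ≥0∞) : EReal) - ((∫⁻ ω, (-f ω).toENNReal ∂P : ℝ≥0∞) : EReal)

/-- The filtering variational objective: the expected logarithm of the particle filter's estimate
of the marginal likelihood of the first `T` observations. Its value may be `-∞`. -/
def fivo {X Z : Type*} [MeasurableSpace X] [MeasurableSpace Z] {ν : Measure X} {μ : Measure Z}
    {T N : ℕ} (C : ℕ → Set (Fin N → ℝ≥0)) (p : SequentialModel ν μ T) (x : ℕ → X)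
    (q : Proposal X μ T) : EReal :=
  extendedExpectation (filterLaw C p q x T) fun s => ENNReal.log (s.1 : ℝ≥0∞)

/-- The set of variational posteriors that maximize the filtering variational objective. -/
def fivoArgmax {X Z : Type*} [MeasurableSpace X] [MeasurableSpace Z] {ν : Measure X}
    {μ : Measure Z} {T N : ℕ} (C : ℕ → Set (Fin N → ℝ≥0)) (p : SequentialModel ν μ T)
    (x : ℕ → X) : Set (Proposal X μ T) :=
  {q | ∀ q' : Proposal X μ T, fivo C p x q' ≤ fivo C p x q}

end

/-! Let Y be the final estimate and `e t` the evidence of the first `t` observations. Reweighting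
and resampling are unbiased, except that model mass outside the support of the proposal is lost, so
Y has mean at most `e T` (`lintegral_weighted_filterLaw`, `lintegral_estimate_le`). Jensen's
inequality for the logarithm, with its equality case (`extendedExpectation_log_le`), bounds the
objective by the logarithm of `e T`, and the bound is reached exactly when Y equals `e T` almost
surely.

The hypothesis on the posteriors says that the predictive density of the next observation given the
latents is the constant `e (t + 1) / e t` on the support of the model (`hasConstantPrediction`). If
the proposal is proportional to the transition density there, every particle that carries weight has
this constant as its incremental weight, and the estimate telescopes to `e T`. Normalizing the
transition densities produces such a proposal, so the bound is attained.

Conversely, let Y be almost surely `e T`. Backwards in time, the estimate at `t + 1` has conditional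
mean at most `e (t + 1) / e t` times the estimate at `t`; hence the latter is at least `e t`, and
since its mean is at most `e t` it equals `e t`. Given the state at time `t`, a weighted sum of
independent incremental weights is then constant. A vanishing variance makes each summand constant,
and the bound on the means fixes the constants (`ae_eq_of_ae_weighted_sum_eq`). The weighted
expectation identity carries this from particles to almost every trajectory in the supports of model
and proposal, and multiplying over time identifies the proposal with the posterior. -/

/-! ### Jensen's inequality for extended expectations of logarithms -/

section Expectation

variable {Ω : Type*} [MeasurableSpace Ω]

theorem extendedExpectation_congr_ae {P : Measure Ω} {f g : Ω → EReal} (h : f =ᵐ[P] g) :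
    extendedExpectation P f = extendedExpectation P g := by
  unfold extendedExpectation
  congr 2 <;> exact lintegral_congr_ae (h.mono fun ω hω => by simp only [hω])

theorem extendedExpectation_const (P : Measure Ω) [IsProbabilityMeasure P] (a : EReal) :
    extendedExpectation P (fun _ => a) = a := by
  unfold extendedExpectation
  simp only [lintegral_const, measure_univ, mul_one, EReal.coe_toENNReal_eq_max]
  rcases le_total 0 a with h | h
  · rw [max_eq_right h, max_eq_left (by simpa using h), sub_zero]
  · rw [max_eq_left h, max_eq_right (by simpa using h), zero_sub, neg_neg]

/-- The positive part of log Y is at most Y, hence integrable, so only the negative part can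
diverge. This reduces Jensen's inequality to a real integral. -/
theorem extendedExpectation_log_eq_bot_or {P : Measure Ω} [IsProbabilityMeasure P] {Y : Ω → ℝ≥0}
    (hY : Measurable Y) (hfin : ∫⁻ ω, (Y ω : ℝ≥0∞) ∂P ≠ ∞) :
    extendedExpectation P (fun ω => ENNReal.log (Y ω)) = ⊥ ∨
      (∀ᵐ ω ∂P, Y ω ≠ 0) ∧ Integrable (fun ω => Real.log (Y ω)) P ∧
      extendedExpectation P (fun ω => ENNReal.log (Y ω)) = ((∫ ω, Real.log (Y ω) ∂P : ℝ) : EReal) := by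
  have hpt : ∀ ω, Y ω ≠ 0 → ENNReal.log (Y ω) = ((Real.log (Y ω) : ℝ) : EReal) :=
    fun ω h => ENNReal.log_of_nnreal h
  have hA : ∫⁻ ω, (ENNReal.log (Y ω)).toENNReal ∂P ≠ ∞ := by
    refine ne_top_of_le_ne_top hfin (lintegral_mono fun ω => ?_)
    by_cases h : Y ω = 0
    · simp [h]
    · rw [hpt ω h, EReal.real_coe_toENNReal, ← ENNReal.ofReal_coe_nnreal]
      exact ENNReal.ofReal_le_ofReal
        ((Real.log_le_sub_one_of_pos (by positivity)).trans (by linarith))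
  by_cases hB : ∫⁻ ω, (-ENNReal.log (Y ω)).toENNReal ∂P = ∞
  · left
    unfold extendedExpectation
    rw [hB]
    lift ∫⁻ ω, (ENNReal.log (Y ω)).toENNReal ∂P to ℝ≥0 using hA with a
    exact EReal.sub_top _
  · right
    have hmeas : Measurable fun ω => (-ENNReal.log (Y ω)).toENNReal := by
      fun_prop
    -- At a zero of Y the negative part of the logarithm is infinite.
    have h0 : ∀ᵐ ω ∂P, Y ω ≠ 0 := by
      filter_upwards [ae_lt_top hmeas hB] with ω hω h
      simp [h] at hω
    have hA' : ∫⁻ ω, (ENNReal.log (Y ω)).toENNReal ∂P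
        = ∫⁻ ω, ENNReal.ofReal (Real.log (Y ω)) ∂P :=
      lintegral_congr_ae (h0.mono fun ω h => by simp only [hpt ω h, EReal.real_coe_toENNReal])
    have hB' : ∫⁻ ω, (-ENNReal.log (Y ω)).toENNReal ∂P
        = ∫⁻ ω, ENNReal.ofReal (-Real.log (Y ω)) ∂P :=
      lintegral_congr_ae (h0.mono fun ω h => by
        simp only [hpt ω h, ← EReal.coe_neg, EReal.real_coe_toENNReal])
    have hint : Integrable (fun ω => Real.log (Y ω)) P := by
      refine ⟨(Real.measurable_log.comp hY.coe_nnreal_real).aestronglyMeasurable, ?_⟩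
      rw [hasFiniteIntegral_iff_norm]
      calc ∫⁻ ω, ENNReal.ofReal ‖Real.log (Y ω)‖ ∂P
          ≤ ∫⁻ ω, (ENNReal.ofReal (Real.log (Y ω)) + ENNReal.ofReal (-Real.log (Y ω))) ∂P := by
            refine lintegral_mono fun ω => ?_
            rcases le_total 0 (Real.log (Y ω)) with h | h
            · simp [abs_of_nonneg h]
            · simp [abs_of_nonpos h]
        _ < ∞ := by
            rw [lintegral_add_left (by fun_prop), ← hA', ← hB']
            exact ENNReal.add_lt_top.2 ⟨hA.lt_top, Ne.lt_top hB⟩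
    refine ⟨h0, hint, ?_⟩
    rw [integral_eq_lintegral_pos_part_sub_lintegral_neg_part hint, ← hA', ← hB']
    unfold extendedExpectation
    lift ∫⁻ ω, (ENNReal.log (Y ω)).toENNReal ∂P to ℝ≥0 using hA with a
    lift ∫⁻ ω, (-ENNReal.log (Y ω)).toENNReal ∂P to ℝ≥0 using hB with b
    rfl

theorem extendedExpectation_log_le {P : Measure Ω} [IsProbabilityMeasure P] {Y : Ω → ℝ≥0}
    (hY : Measurable Y) {c : ℝ≥0} (hc : c ≠ 0) (hle : ∫⁻ ω, (Y ω : ℝ≥0∞) ∂P ≤ c) :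
    extendedExpectation P (fun ω => ENNReal.log (Y ω)) ≤ ENNReal.log c ∧
      (extendedExpectation P (fun ω => ENNReal.log (Y ω)) = ENNReal.log c → ∀ᵐ ω ∂P, Y ω = c) := by
  have hfin : ∫⁻ ω, (Y ω : ℝ≥0∞) ∂P ≠ ∞ := ne_top_of_le_ne_top ENNReal.coe_ne_top hle
  have hlogc : ENNReal.log c = ((Real.log c : ℝ) : EReal) := ENNReal.log_of_nnreal hc
  rcases extendedExpectation_log_eq_bot_or hY hfin with h | ⟨h0, hint, h⟩
  · rw [h, hlogc]
    exact ⟨bot_le, fun h' => absurd h'.symm (EReal.coe_ne_bot _)⟩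
  rw [h, hlogc, EReal.coe_le_coe_iff, EReal.coe_eq_coe_iff]
  have hc' : (0 : ℝ) < c := by positivity
  have hYint : Integrable (fun ω => (Y ω : ℝ)) P := by
    refine ⟨by fun_prop, ?_⟩
    rw [hasFiniteIntegral_iff_norm]
    simpa [Real.norm_eq_abs] using hfin.lt_top
  have hYle : ∫ ω, (Y ω : ℝ) ∂P ≤ c := by
    rw [integral_eq_lintegral_of_nonneg_ae (.of_forall fun ω => by positivity) (by fun_prop)]
    simp only [ENNReal.ofReal_coe_nnreal]
    exact ENNReal.toReal_le_coe_of_le_coe hle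
  -- The gap in log u ≤ u - 1 at u = Y / c: nonnegative, and zero only at u = 1. Integrating it
  -- gives the inequality, and its vanishing integral gives the equality case.
  let d : Ω → ℝ := fun ω => (Y ω : ℝ) / c - 1 - (Real.log (Y ω) - Real.log c)
  have hd0 : ∀ᵐ ω ∂P, 0 ≤ d ω := by
    filter_upwards [h0] with ω hω
    have hy : (0 : ℝ) < Y ω := by positivity
    have := Real.log_le_sub_one_of_pos (div_pos hy hc')
    rw [Real.log_div hy.ne' hc'.ne'] at this
    simp only [d]; linarith
  have hdint : Integrable d P :=
    ((hYint.div_const _).sub (integrable_const 1)).sub (hint.sub (integrable_const _))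
  have hdval : ∫ ω, d ω ∂P = (∫ ω, (Y ω : ℝ) ∂P) / c - 1 - (∫ ω, Real.log (Y ω) ∂P - Real.log c) := by
    have h1 : Integrable (fun ω => (Y ω : ℝ) / c - 1) P :=
      (hYint.div_const _).sub (integrable_const 1)
    have h2 : Integrable (fun ω => Real.log (Y ω) - Real.log c) P :=
      hint.sub (integrable_const _)
    simp only [d]
    rw [integral_sub h1 h2, integral_sub (hYint.div_const _) (integrable_const 1),
      integral_sub hint (integrable_const _), integral_div]
    simp
  have hle1 : (∫ ω, (Y ω : ℝ) ∂P) / c ≤ 1 := (div_le_one hc').2 hYle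
  have hdn : 0 ≤ ∫ ω, d ω ∂P := integral_nonneg_of_ae hd0
  refine ⟨by linarith, fun heq => ?_⟩
  have hz : ∫ ω, d ω ∂P = 0 := le_antisymm (by linarith) hdn
  filter_upwards [h0, (integral_eq_zero_iff_of_nonneg_ae hd0 hdint).1 hz] with ω hω hdω
  have hy : (0 : ℝ) < Y ω := by positivity
  by_contra hne
  have hne' : (Y ω : ℝ) / c ≠ 1 := fun h => hne (by
    rw [div_eq_one_iff_eq hc'.ne'] at h; exact_mod_cast h)
  have := Real.log_lt_sub_one_of_pos (div_pos hy hc') hne'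
  rw [Real.log_div hy.ne' hc'.ne'] at this
  simp only [d, Pi.zero_apply] at hdω
  linarith

end Expectation

/-! ### Constant sums of independent variables -/

section ProductSum

variable {Z : Type*} [MeasurableSpace Z]

/-- If a sum of functions of independent variables is almost surely constant, then so is each
summand. -/
theorem ae_const_of_ae_sum_const {N : ℕ} (P : Fin N → Measure Z)
    [∀ i, IsProbabilityMeasure (P i)] {f : Fin N → Z → ℝ≥0} (hf : ∀ i, Measurable (f i)) {c : ℝ≥0}
    (h : ∀ᵐ z ∂Measure.pi P, ∑ i, f i (z i) = c) (i : Fin N) :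
    ∃ k : ℝ≥0, ∀ᵐ z ∂P i, f i z = k := by
  -- Nonnegative summands are bounded by their sum, so all variances below are finite.
  have hbd : ∀ i, ∀ᵐ z ∂P i, f i z ≤ c := by
    intro i
    have hm : MeasurableSet {y : Z | f i y ≤ c} := measurableSet_le (hf i) measurable_const
    rw [← (measurePreserving_eval P i).map_eq]
    refine (ae_map_iff (measurePreserving_eval P i).measurable.aemeasurable hm).2 ?_
    filter_upwards [h] with z hz
    rw [← hz]
    exact Finset.single_le_sum (f := fun i => f i (z i)) (fun _ _ => zero_le) (Finset.mem_univ i)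
  have hL : ∀ i, MemLp (fun z => (f i z : ℝ)) 2 (P i) := fun i =>
    MemLp.of_bound (by fun_prop) c ((hbd i).mono fun z hz => by simpa using hz)
  -- By independence the variances add up to the variance of a constant, so each of them is zero.
  have hvar := ProbabilityTheory.variance_sum_pi (μ := P) (X := fun i z => (f i z : ℝ)) hL
  rw [ProbabilityTheory.variance_congr (Y := fun _ => (c : ℝ))
    (h.mono fun z hz => by simp [← hz]),
    show ProbabilityTheory.variance (fun _ => (c : ℝ)) (Measure.pi P) = 0 by
      simp [ProbabilityTheory.variance_eq_integral], eq_comm,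
    Finset.sum_eq_zero_iff_of_nonneg (fun _ _ => ProbabilityTheory.variance_nonneg _ _)] at hvar
  have hi := hvar i (Finset.mem_univ i)
  have hev : ProbabilityTheory.evariance (fun z => (f i z : ℝ)) (P i) = 0 := by
    rw [← (hL i).ofReal_variance_eq, hi, ENNReal.ofReal_zero]
  refine ⟨(∫ z, (f i z : ℝ) ∂P i).toNNReal, ?_⟩
  filter_upwards [(ProbabilityTheory.evariance_eq_zero_iff (by fun_prop)).1 hev] with z hz
  rw [← hz, Real.toNNReal_coe]

/-- If a weighted sum of functions of independent variables is almost surely equal to an upper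
bound `c` of their means, where the weights have sum at most one, then each function of nonzero
weight is almost surely equal to `c`. -/
theorem ae_eq_of_ae_weighted_sum_eq {N : ℕ} (P : Fin N → Measure Z)
    [∀ i, IsProbabilityMeasure (P i)] {f : Fin N → Z → ℝ≥0} (hf : ∀ i, Measurable (f i)) {c : ℝ≥0}
    {w : Fin N → ℝ≥0} (hw : ∑ i, w i ≤ 1)
    (hmean : ∀ i, w i ≠ 0 → ∫⁻ z, (f i z : ℝ≥0∞) ∂P i ≤ c)
    (h : ∀ᵐ z ∂Measure.pi P, ∑ i, w i * f i (z i) = c) (i : Fin N) (hi : w i ≠ 0) :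
    ∀ᵐ z ∂P i, f i z = c := by
  choose k hk using ae_const_of_ae_sum_const P (f := fun i z => w i * f i z)
    (fun i => (hf i).const_mul _) h
  have hkle : ∀ i, k i ≤ w i * c := by
    intro i
    by_cases hwi : w i = 0
    · obtain ⟨z, hz⟩ := (hk i).exists
      simp [← hz, hwi]
    have h1 : ∫⁻ z, ((w i * f i z : ℝ≥0) : ℝ≥0∞) ∂P i = k i := by
      rw [lintegral_congr_ae (g := fun _ => (k i : ℝ≥0∞)) ((hk i).mono fun z hz => by simp only [hz])]
      simp
    have h2 : (k i : ℝ≥0∞) ≤ w i * c := by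
      rw [← h1]
      simp only [ENNReal.coe_mul]
      rw [lintegral_const_mul _ (by fun_prop)]
      gcongr
      exact hmean i hwi
    exact_mod_cast h2
  have hsum : ∑ i, k i = c := by
    have hall : ∀ᵐ z ∂Measure.pi P, ∀ i, w i * f i (z i) = k i :=
      ae_all_iff.2 fun i => (measurePreserving_eval P i).quasiMeasurePreserving.ae (hk i)
    obtain ⟨z, hz, hz'⟩ := (h.and hall).exists
    rw [← hz]
    exact Finset.sum_congr rfl fun i _ => (hz' i).symm
  -- The chain c = ∑ k i ≤ ∑ w i * c ≤ c forces equality in every term.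
  have hki : k i = w i * c := by
    have hle : ∑ i, w i * c ≤ ∑ i, k i := by
      rw [hsum, ← Finset.sum_mul]
      exact mul_le_of_le_one_left zero_le hw
    have heq : ∑ i, k i = ∑ i, w i * c :=
      le_antisymm (Finset.sum_le_sum fun i _ => hkle i) hle
    exact (Finset.sum_eq_sum_iff_of_le fun i _ => hkle i).1 heq i (Finset.mem_univ i)
  filter_upwards [hk i] with z hz
  exact mul_left_cancel₀ hi (hz.trans hki)

end ProductSum

/-! ### Sequential densities and iterated integration over trajectories -/

section Chain

variable {Z : Type*}

/-- The joint density of the first `t` terms of a sequence with conditional densities `d`. -/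
noncomputable def chainDensity (d : (t : ℕ) → (Fin t → Z) → Z → ℝ≥0) (t : ℕ) (z : Fin t → Z) : ℝ≥0 :=
  ∏ s : Fin t, d s (latentPrefix z s) (z s)

theorem concat_castSucc {t : ℕ} (z : Fin t → Z) (z' : Z) (i : Fin t) :
    concat z z' i.castSucc = z i := by
  simp [concat]

theorem concat_last {t : ℕ} (z : Fin t → Z) (z' : Z) : concat z z' (Fin.last t) = z' := by
  simp [concat]

theorem chainDensity_zero (d : (t : ℕ) → (Fin t → Z) → Z → ℝ≥0) (z : Fin 0 → Z) :
    chainDensity d 0 z = 1 := by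
  simp [chainDensity]

theorem chainDensity_concat (d : (t : ℕ) → (Fin t → Z) → Z → ℝ≥0) {t : ℕ} (z : Fin t → Z) (z' : Z) :
    chainDensity d (t + 1) (concat z z') = chainDensity d t z * d t z z' := by
  have h1 : ∀ s : Fin t, latentPrefix (concat z z') s.castSucc = latentPrefix z s := by
    intro s
    ext i
    exact concat_castSucc z z' (Fin.castLE s.isLt.le i)
  have h2 : latentPrefix (concat z z') (Fin.last t) = z := by
    ext i
    exact concat_castSucc z z' i
  unfold chainDensity
  rw [Fin.prod_univ_castSucc]
  congr 1
  · refine Finset.prod_congr rfl fun s _ => ?_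
    rw [h1 s, concat_castSucc]
    rfl
  · rw [h2, concat_last]
    rfl

variable [MeasurableSpace Z]

theorem measurable_concat {t : ℕ} :
    Measurable fun a : (Fin t → Z) × Z => concat a.1 a.2 := by
  refine measurable_pi_lambda _ fun i => ?_
  refine Fin.lastCases ?_ (fun j => ?_) i
  · simpa only [concat_last] using measurable_snd
  · simpa only [concat_castSucc] using measurable_fst.eval

theorem measurable_latentPrefix {t : ℕ} (s : Fin t) :
    Measurable fun z : Fin t → Z => latentPrefix z s :=
  measurable_pi_lambda _ fun _ => measurable_pi_apply _

theorem measurable_chainDensity {d : (t : ℕ) → (Fin t → Z) → Z → ℝ≥0} {t : ℕ}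
    (hd : ∀ s < t, Measurable fun a : (Fin s → Z) × Z => d s a.1 a.2) :
    Measurable (chainDensity d t) := by
  refine Finset.measurable_fun_prod _ fun s _ => ?_
  exact (hd s s.isLt).comp ((measurable_latentPrefix s).prodMk (measurable_pi_apply s))

theorem lintegral_pi_zero (μ : Measure Z) (f : (Fin 0 → Z) → ℝ≥0∞) :
    ∫⁻ z, f z ∂(Measure.pi fun _ : Fin 0 => μ) = f Fin.elim0 := by
  rw [Measure.pi_of_empty (fun _ : Fin 0 => μ) Fin.elim0, lintegral_dirac]

variable (μ : Measure Z) [SigmaFinite μ]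

theorem measurePreserving_concat (t : ℕ) :
    MeasurePreserving (fun a : (Fin t → Z) × Z => concat a.1 a.2)
      ((Measure.pi fun _ : Fin t => μ).prod μ) (Measure.pi fun _ : Fin (t + 1) => μ) := by
  have h := (measurePreserving_piFinSuccAbove (fun _ : Fin (t + 1) => μ) (Fin.last t)).symm
  have h' := h.comp (Measure.measurePreserving_swap
    (μ := Measure.pi fun _ : Fin t => μ) (ν := μ))
  convert h' using 1
  ext a : 1
  simp only [Function.comp_apply, MeasurableEquiv.piFinSuccAbove_symm_apply]
  exact (Fin.insertNth_last' (β := Z) a.2 a.1).symm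

theorem lintegral_pi_succ {t : ℕ} {f : (Fin (t + 1) → Z) → ℝ≥0∞} (hf : Measurable f) :
    ∫⁻ z, f z ∂(Measure.pi fun _ : Fin (t + 1) => μ)
      = ∫⁻ z, ∫⁻ z', f (concat z z') ∂μ ∂(Measure.pi fun _ : Fin t => μ) := by
  rw [← (measurePreserving_concat μ t).lintegral_comp hf,
    lintegral_prod (fun a => f (concat a.1 a.2)) (hf.comp measurable_concat).aemeasurable]

theorem ae_pi_succ {t : ℕ} {P : (Fin (t + 1) → Z) → Prop} (hP : MeasurableSet {z | P z}) :
    (∀ᵐ z ∂(Measure.pi fun _ : Fin (t + 1) => μ), P z) ↔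
      ∀ᵐ z ∂(Measure.pi fun _ : Fin t => μ), ∀ᵐ z' ∂μ, P (concat z z') := by
  rw [← (measurePreserving_concat μ t).map_eq, ae_map_iff measurable_concat.aemeasurable hP,
    Measure.ae_prod_iff_ae_ae (p := fun a => P (concat a.1 a.2)) (measurable_concat hP)]

theorem measurableSet_ae {A : Type*} [MeasurableSpace A] {S : Set (A × Z)} (hS : MeasurableSet S) :
    MeasurableSet {a | ∀ᵐ z ∂μ, (a, z) ∈ S} :=
  measurable_measure_prodMk_left (ν := μ) hS.compl (measurableSet_singleton 0)

end Chain

/-! ### Transition densities and the law of the proposed latents -/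

section Transition

variable {X Z : Type*} [MeasurableSpace X] [MeasurableSpace Z]
  {ν : Measure X} {μ : Measure Z} {T : ℕ}

/-- The density of the next observation-latent pair of a sequential model, at the next term of the
observation sequence `x`, as a function of the previous latents and the next one. -/
def SequentialModel.transition (p : SequentialModel ν μ T) (x : ℕ → X) (t : ℕ)
    (zs : Fin t → Z) (z : Z) : ℝ≥0 :=
  p.dens t (obs x t) zs (x t) z

/-- The density of the next latent under a variational posterior, along the observation
sequence `x`. -/
def Proposal.transition (q : Proposal X μ T) (x : ℕ → X) (t : ℕ) (zs : Fin t → Z) (z : Z) : ℝ≥0 :=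
  q.dens t (obs x (t + 1)) zs z

theorem SequentialModel.joint_eq (p : SequentialModel ν μ T) (x : ℕ → X) (t : ℕ) :
    p.joint x t = chainDensity (p.transition x) t := rfl

theorem Proposal.joint_eq (q : Proposal X μ T) (x : ℕ → X) :
    q.joint x = chainDensity (q.transition x) T := rfl

theorem SequentialModel.measurable_transition (p : SequentialModel ν μ T) (x : ℕ → X) {t : ℕ}
    (ht : t < T) : Measurable fun a : (Fin t → Z) × Z => p.transition x t a.1 a.2 :=
  (p.measurable_dens t ht).comp (measurable_const.prodMk
    (measurable_fst.prodMk (measurable_const.prodMk measurable_snd)))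

theorem Proposal.measurable_transition (q : Proposal X μ T) (x : ℕ → X) {t : ℕ}
    (ht : t < T) : Measurable fun a : (Fin t → Z) × Z => q.transition x t a.1 a.2 :=
  (q.measurable_dens t ht).comp (measurable_const.prodMk
    (measurable_fst.prodMk measurable_snd))

theorem Proposal.lintegral_transition (q : Proposal X μ T) (x : ℕ → X) {t : ℕ}
    (ht : t < T) (zs : Fin t → Z) : ∫⁻ z, (q.transition x t zs z : ℝ≥0∞) ∂μ = 1 :=
  q.lintegral_dens t ht _ _

theorem Proposal.isProbabilityMeasure (q : Proposal X μ T) (x : ℕ → X) {t : ℕ}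
    (ht : t < T) (zs : Fin t → Z) :
    IsProbabilityMeasure (μ.withDensity fun z => (q.transition x t zs z : ℝ≥0∞)) :=
  ⟨by rw [withDensity_apply _ .univ, Measure.restrict_univ, q.lintegral_transition x ht]⟩

theorem incrementalWeight_eq (p : SequentialModel ν μ T) (q : Proposal X μ T) (x : ℕ → X) (t : ℕ)
    (zs : Fin t → Z) (z : Z) :
    incrementalWeight p q x t zs z = p.transition x t zs z / q.transition x t zs z := rfl

theorem measurable_incrementalWeight (p : SequentialModel ν μ T) (q : Proposal X μ T) (x : ℕ → X)
    {t : ℕ} (ht : t < T) :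
    Measurable fun a : (Fin t → Z) × Z => incrementalWeight p q x t a.1 a.2 :=
  (p.measurable_transition x ht).div (q.measurable_transition x ht)

variable {N : ℕ}

theorem proposalLaw_eq (q : Proposal X μ T) (x : ℕ → X) (t : ℕ) (zs : Fin N → Fin t → Z) :
    proposalLaw q x t zs =
      Measure.pi fun i => μ.withDensity fun z => (q.transition x t (zs i) z : ℝ≥0∞) := rfl

theorem isProbabilityMeasure_proposalLaw (q : Proposal X μ T) (x : ℕ → X) {t : ℕ} (ht : t < T)
    (zs : Fin N → Fin t → Z) : IsProbabilityMeasure (proposalLaw q x t zs) := by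
  have := fun i => q.isProbabilityMeasure x ht (zs i)
  rw [proposalLaw_eq]
  infer_instance

/-- Boxes form a generating π-system, and on a box the law is a finite product of integrals that
depend measurably on the trajectories. -/
theorem measurable_proposalLaw [SigmaFinite μ] (q : Proposal X μ T) (x : ℕ → X) {t : ℕ}
    (ht : t < T) : Measurable fun zs : Fin N → Fin t → Z => proposalLaw q x t zs := by
  have := fun zs : Fin N → Fin t → Z => isProbabilityMeasure_proposalLaw q x ht zs
  refine Measurable.measure_of_isPiSystem_of_isProbabilityMeasure
    generateFrom_pi.symm isPiSystem_pi ?_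
  rintro _ ⟨A, hA, rfl⟩
  have hA' : ∀ i, MeasurableSet (A i) := fun i => hA i (Set.mem_univ i)
  have hP := fun zs => q.isProbabilityMeasure x ht zs
  simp only [proposalLaw_eq, Measure.pi_pi, withDensity_apply _ (hA' _)]
  refine Finset.measurable_fun_prod _ fun i _ => ?_
  have h : Measurable fun zs : Fin t → Z =>
      ∫⁻ z in A i, (q.transition x t zs z : ℝ≥0∞) ∂μ :=
    (q.measurable_transition x ht).coe_nnreal_ennreal.lintegral_prod_right'
  exact h.comp (measurable_pi_apply i)

theorem lintegral_proposalLaw_eval (q : Proposal X μ T) (x : ℕ → X) {t : ℕ} (ht : t < T)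
    (zs : Fin N → Fin t → Z) (i : Fin N) {f : Z → ℝ≥0∞} (hf : Measurable f) :
    ∫⁻ z, f (z i) ∂proposalLaw q x t zs = ∫⁻ z, q.transition x t (zs i) z * f z ∂μ := by
  have := fun i => q.isProbabilityMeasure x ht (zs i)
  have hq : Measurable fun z => (q.transition x t (zs i) z : ℝ≥0∞) :=
    ((q.measurable_transition x ht).comp measurable_prodMk_left).coe_nnreal_ennreal
  rw [proposalLaw_eq, (measurePreserving_eval (fun i => μ.withDensity fun z =>
    (q.transition x t (zs i) z : ℝ≥0∞)) i).lintegral_comp hf,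
    lintegral_withDensity_eq_lintegral_mul _ hq hf]
  rfl

end Transition

/-! ### Integration against the resampling step -/

section Resample

theorem categorical_singleton {N : ℕ} (w : Fin N → ℝ≥0) (i : Fin N) : categorical w {i} = w i := by
  simp [categorical, Measure.finsetSum_apply, Set.indicator_apply]

theorem lintegral_categorical {N : ℕ} (w : Fin N → ℝ≥0) (f : Fin N → ℝ≥0∞) :
    ∫⁻ i, f i ∂categorical w = ∑ i, w i * f i := by
  rw [lintegral_fintype]
  exact Finset.sum_congr rfl fun i _ => by rw [categorical_singleton, mul_comm]

theorem isProbabilityMeasure_categorical {N : ℕ} {w : Fin N → ℝ≥0} (hw : ∑ i, w i = 1) :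
    IsProbabilityMeasure (categorical w) := by
  refine ⟨?_⟩
  rw [← lintegral_one, lintegral_categorical]
  simp only [mul_one]
  exact_mod_cast hw

instance {N : ℕ} (w : Fin N → ℝ≥0) : IsFiniteMeasure (categorical w) := by
  refine ⟨?_⟩
  rw [← lintegral_one, lintegral_categorical]
  simp [ENNReal.sum_lt_top]

variable {Z : Type*} [MeasurableSpace Z] {N t : ℕ}

open Classical in
theorem lintegral_resample (C : Set (Fin N → ℝ≥0)) (s : FilterState Z N t)
    {F : FilterState Z N t → ℝ≥0∞} (hF : Measurable F) :
    ∫⁻ s', F s' ∂resample C s =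
      if s.2.1 ∈ C ∧ ∑ i, s.2.1 i ≠ 0 then
        ∫⁻ a, F (s.1, fun _ => (N : ℝ≥0)⁻¹, fun i => s.2.2 (a i))
          ∂Measure.pi fun _ : Fin N => categorical s.2.1
      else F s := by
  unfold resample
  split_ifs
  · rw [lintegral_map hF .of_discrete]
  · rw [lintegral_dirac' _ hF]

theorem measurable_lintegral_resample {C : Set (Fin N → ℝ≥0)} (hC : MeasurableSet C)
    {F : FilterState Z N t → ℝ≥0∞} (hF : Measurable F) :
    Measurable fun s : FilterState Z N t => ∫⁻ s', F s' ∂resample C s := by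
  classical
  simp only [lintegral_resample C _ hF]
  refine Measurable.ite ?_ ?_ hF
  · refine MeasurableSet.inter ((measurable_fst.comp measurable_snd) hC) ?_
    have : Measurable fun s : FilterState Z N t => ∑ i, s.2.1 i := by fun_prop
    exact this (measurableSet_singleton 0).compl
  · simp only [lintegral_fintype, Measure.pi_singleton, categorical_singleton]
    refine Finset.measurable_fun_sum _ fun a _ => Measurable.mul (hF.comp ?_) (by fun_prop)
    refine measurable_fst.prodMk (measurable_const.prodMk ?_)
    exact measurable_pi_lambda _ fun i => by fun_prop

theorem measurable_resample {C : Set (Fin N → ℝ≥0)} (hC : MeasurableSet C) :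
    Measurable (resample C : FilterState Z N t → Measure (FilterState Z N t)) := by
  refine Measure.measurable_of_measurable_coe _ fun A hA => ?_
  simp only [← lintegral_indicator_one hA]
  exact measurable_lintegral_resample hC (measurable_one.indicator hA)

/-- Weights of sum one make the ancestor law a probability measure; weights of sum zero are never
resampled. -/
theorem lintegral_resample_of_const (C : Set (Fin N → ℝ≥0)) {s : FilterState Z N t}
    (hs : ∑ i, s.2.1 i = 0 ∨ ∑ i, s.2.1 i = 1) {F : FilterState Z N t → ℝ≥0∞} (hF : Measurable F)
    (h : ∀ a : Fin N → Fin N, F (s.1, fun _ => (N : ℝ≥0)⁻¹, fun i => s.2.2 (a i)) = F s) :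
    ∫⁻ s', F s' ∂resample C s = F s := by
  rw [lintegral_resample C s hF]
  split_ifs with hc
  · have := isProbabilityMeasure_categorical (hs.resolve_left hc.2)
    simp [h]
  · rfl

/-- Resampling is unbiased: each of the `N` draws has the old weighted sum as its mean value of `φ`,
and the new weights `1 / N` average these equal means. -/
theorem lintegral_resample_weighted (hN : 0 < N) (C : Set (Fin N → ℝ≥0)) {s : FilterState Z N t}
    (hs : ∑ i, s.2.1 i = 0 ∨ ∑ i, s.2.1 i = 1) {φ : (Fin t → Z) → ℝ≥0∞} (hφ : Measurable φ) :
    ∫⁻ s', (s'.1 : ℝ≥0∞) * ∑ i, s'.2.1 i * φ (s'.2.2 i) ∂resample C s =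
      s.1 * ∑ i, s.2.1 i * φ (s.2.2 i) := by
  rw [lintegral_resample C s (by fun_prop)]
  split_ifs with hc
  · have := isProbabilityMeasure_categorical (hs.resolve_left hc.2)
    simp only
    rw [lintegral_const_mul _ .of_discrete, lintegral_finsetSum _ fun _ _ => .of_discrete]
    have h : ∀ i : Fin N, ∫⁻ a, (((N : ℝ≥0)⁻¹ : ℝ≥0) : ℝ≥0∞) * φ (s.2.2 (a i))
        ∂Measure.pi (fun _ : Fin N => categorical s.2.1) =
        (((N : ℝ≥0)⁻¹ : ℝ≥0) : ℝ≥0∞) * ∑ j, s.2.1 j * φ (s.2.2 j) := by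
      intro i
      rw [lintegral_const_mul _ .of_discrete, (measurePreserving_eval
        (fun _ : Fin N => categorical s.2.1) i).lintegral_comp (f := fun j => φ (s.2.2 j))
        .of_discrete, lintegral_categorical]
    simp only [h]
    rw [Finset.sum_const, Finset.card_univ, Fintype.card_fin, nsmul_eq_mul, ← mul_assoc (N : ℝ≥0∞)]
    have hNN : (N : ℝ≥0∞) * (((N : ℝ≥0)⁻¹ : ℝ≥0) : ℝ≥0∞) = 1 := by
      have : (N : ℝ≥0) * (N : ℝ≥0)⁻¹ = 1 := mul_inv_cancel₀ (by positivity)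
      exact_mod_cast this
    rw [hNN, one_mul]
  · rfl

end Resample

/-! ### The law of the filter and its weighted expectations -/

section FilterLaw

variable {X Z : Type*} [MeasurableSpace X] [MeasurableSpace Z]
  {ν : Measure X} {μ : Measure Z} {T N t : ℕ}

/-- The likelihood increment of a particle filter whose particles are extended by `z`. -/
noncomputable def increment (p : SequentialModel ν μ T) (q : Proposal X μ T) (x : ℕ → X) (t : ℕ)
    (s : FilterState Z N t) (z : Fin N → Z) : ℝ≥0 :=
  ∑ i, s.2.1 i * incrementalWeight p q x t (s.2.2 i) (z i)

variable (p : SequentialModel ν μ T) (q : Proposal X μ T) (x : ℕ → X)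

theorem reweight_fst (s : FilterState Z N t) (z : Fin N → Z) :
    (reweight p q x t s z).1 = s.1 * increment p q x t s z := rfl

theorem reweight_weight (s : FilterState Z N t) (z : Fin N → Z) (i : Fin N) :
    (reweight p q x t s z).2.1 i =
      s.2.1 i * incrementalWeight p q x t (s.2.2 i) (z i) / increment p q x t s z := rfl

theorem reweight_trajectory (s : FilterState Z N t) (z : Fin N → Z) (i : Fin N) :
    (reweight p q x t s z).2.2 i = concat (s.2.2 i) (z i) := rfl

theorem sum_reweight_weight (s : FilterState Z N t) (z : Fin N → Z) :
    ∑ i, (reweight p q x t s z).2.1 i = increment p q x t s z / increment p q x t s z := by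
  simp only [reweight_weight, ← Finset.sum_div]
  rfl

theorem sum_reweight_weight_eq_zero_or (s : FilterState Z N t) (z : Fin N → Z) :
    ∑ i, (reweight p q x t s z).2.1 i = 0 ∨ ∑ i, (reweight p q x t s z).2.1 i = 1 := by
  rw [sum_reweight_weight]
  by_cases h : increment p q x t s z = 0
  · simp [h]
  · exact .inr (div_self h)

variable {p q x}

theorem measurable_weightedIncrement (ht : t < T) (i : Fin N) :
    Measurable fun a : FilterState Z N t × (Fin N → Z) =>
      a.1.2.1 i * incrementalWeight p q x t (a.1.2.2 i) (a.2 i) := by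
  refine Measurable.mul (by fun_prop) ?_
  exact (measurable_incrementalWeight p q x ht).comp
    (g := fun b : (Fin t → Z) × Z => incrementalWeight p q x t b.1 b.2)
    (f := fun a : FilterState Z N t × (Fin N → Z) => (a.1.2.2 i, a.2 i))
    (by fun_prop)

theorem measurable_increment (ht : t < T) :
    Measurable fun a : FilterState Z N t × (Fin N → Z) => increment p q x t a.1 a.2 :=
  Finset.measurable_fun_sum _ fun i _ => measurable_weightedIncrement ht i

theorem measurable_reweight (ht : t < T) :
    Measurable fun a : FilterState Z N t × (Fin N → Z) => reweight p q x t a.1 a.2 := by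
  refine ((measurable_fst.comp measurable_fst).mul (measurable_increment ht)).prodMk
    (Measurable.prodMk ?_ ?_)
  · exact measurable_pi_lambda _ fun i =>
      (measurable_weightedIncrement ht i).div (measurable_increment ht)
  · refine measurable_pi_lambda _ fun i => ?_
    exact measurable_concat.comp
      (f := fun a : FilterState Z N t × (Fin N → Z) => (a.1.2.2 i, a.2 i)) (by fun_prop)

variable [SigmaFinite μ]

theorem measurable_lintegral_proposalLaw (ht : t < T)
    {F : FilterState Z N t × (Fin N → Z) → ℝ≥0∞} (hF : Measurable F) :
    Measurable fun s : FilterState Z N t => ∫⁻ z, F (s, z) ∂proposalLaw q x t s.2.2 := by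
  let κ : ProbabilityTheory.Kernel (FilterState Z N t) (Fin N → Z) :=
    ⟨fun s => proposalLaw q x t s.2.2, (measurable_proposalLaw q x ht).comp
      (measurable_snd.comp measurable_snd)⟩
  have : ProbabilityTheory.IsMarkovKernel κ :=
    ⟨fun s => isProbabilityMeasure_proposalLaw q x ht s.2.2⟩
  exact hF.lintegral_kernel_prod_right' (κ := κ)

variable {C : ℕ → Set (Fin N → ℝ≥0)}

theorem lintegral_filterLaw_succ (hC : ∀ t, MeasurableSet (C t)) (ht : t < T)
    {F : FilterState Z N (t + 1) → ℝ≥0∞} (hF : Measurable F) :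
    ∫⁻ s, F s ∂filterLaw C p q x (t + 1) =
      ∫⁻ s, ∫⁻ z, ∫⁻ s', F s' ∂resample (C t) (reweight p q x t s z) ∂proposalLaw q x t s.2.2
        ∂filterLaw C p q x t := by
  have hres : ∀ s : FilterState Z N t,
      Measurable fun z => resample (C t) (reweight p q x t s z) := fun s =>
    (measurable_resample (hC t)).comp ((measurable_reweight ht).comp measurable_prodMk_left)
  have hbind : ∀ (s : FilterState Z N t) {G : FilterState Z N (t + 1) → ℝ≥0∞}, Measurable G →
      ∫⁻ s', G s' ∂((proposalLaw q x t s.2.2).bind fun z => resample (C t) (reweight p q x t s z)) =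
        ∫⁻ z, ∫⁻ s', G s' ∂resample (C t) (reweight p q x t s z) ∂proposalLaw q x t s.2.2 :=
    fun s G hG => Measure.lintegral_bind (hres s).aemeasurable hG.aemeasurable
  have hmeas : Measurable fun s : FilterState Z N t =>
      (proposalLaw q x t s.2.2).bind fun z => resample (C t) (reweight p q x t s z) := by
    refine Measure.measurable_of_measurable_coe _ fun A hA => ?_
    simp only [← lintegral_indicator_one hA, hbind _ (measurable_one.indicator hA)]
    exact measurable_lintegral_proposalLaw ht
      ((measurable_lintegral_resample (hC t) (measurable_one.indicator hA)).comp
        (measurable_reweight ht))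
  rw [filterLaw, Measure.lintegral_bind hmeas.aemeasurable hF.aemeasurable]
  exact lintegral_congr fun s => hbind s hF

/-- Resampling does not touch the likelihood estimate, so it disappears from the recursion. -/
theorem lintegral_estimate_filterLaw_succ (hC : ∀ t, MeasurableSet (C t)) (ht : t < T)
    {f : ℝ≥0 → ℝ≥0∞} (hf : Measurable f) :
    ∫⁻ s, f s.1 ∂filterLaw C p q x (t + 1) =
      ∫⁻ s, ∫⁻ z, f (s.1 * increment p q x t s z) ∂proposalLaw q x t s.2.2
        ∂filterLaw C p q x t := by
  rw [lintegral_filterLaw_succ hC ht (F := fun s => f s.1) (hf.comp measurable_fst)]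
  refine lintegral_congr fun s => lintegral_congr fun z => ?_
  exact lintegral_resample_of_const (C t) (sum_reweight_weight_eq_zero_or p q x s z)
    (F := fun s => f s.1) (hf.comp measurable_fst) fun _ => rfl

theorem isProbabilityMeasure_filterLaw (hC : ∀ t, MeasurableSet (C t)) (ht : t ≤ T) :
    IsProbabilityMeasure (filterLaw C p q x t) := by
  induction t with
  | zero => rw [filterLaw]; infer_instance
  | succ t ih =>
    have := ih (by omega)
    have := fun zs : Fin N → Fin t → Z => isProbabilityMeasure_proposalLaw q x ht zs
    refine ⟨?_⟩
    rw [← lintegral_one,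
      lintegral_estimate_filterLaw_succ hC ht (f := fun _ => 1) measurable_const]
    simp

theorem ae_estimate_filterLaw_succ (hC : ∀ t, MeasurableSet (C t)) (ht : t < T) (c : ℝ≥0) :
    (∀ᵐ s ∂filterLaw C p q x (t + 1), s.1 = c) ↔
      ∀ᵐ s ∂filterLaw C p q x t, ∀ᵐ z ∂proposalLaw q x t s.2.2,
        s.1 * increment p q x t s z = c := by
  classical
  -- An almost sure statement is the vanishing of the integral of this indicator, to which the
  -- recursion for integrals applies.
  let f : ℝ≥0 → ℝ≥0∞ := fun y => if y = c then 0 else 1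
  have hf : Measurable f :=
    Measurable.ite (measurableSet_singleton c) measurable_const measurable_const
  have hf0 : ∀ y, f y = 0 ↔ y = c := by
    intro y
    by_cases h : y = c <;> simp [f, h]
  have hm : Measurable fun a : FilterState Z N t × (Fin N → Z) =>
      f (a.1.1 * increment p q x t a.1 a.2) :=
    hf.comp ((measurable_fst.comp measurable_fst).mul (measurable_increment ht))
  have h := lintegral_estimate_filterLaw_succ (C := C) (p := p) (q := q) (x := x) hC ht hf
  have h1 : (∀ᵐ s ∂filterLaw C p q x (t + 1), s.1 = c) ↔
      ∫⁻ s, f s.1 ∂filterLaw C p q x (t + 1) = 0 := by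
    rw [lintegral_eq_zero_iff (f := fun s : FilterState Z N (t + 1) => f s.1)
      (hf.comp measurable_fst)]
    exact Filter.eventually_congr (.of_forall fun s => (hf0 s.1).symm)
  rw [h1, h, lintegral_eq_zero_iff (measurable_lintegral_proposalLaw ht hm)]
  refine Filter.eventually_congr (.of_forall fun s => ?_)
  simp only [Pi.zero_apply]
  rw [lintegral_eq_zero_iff (f := fun z => f (s.1 * increment p q x t s z))
    (hm.comp measurable_prodMk_left)]
  exact Filter.eventually_congr (.of_forall fun z => hf0 _)

theorem ae_estimate_eq_zero_or_sum_weight (hN : 0 < N) (hC : ∀ t, MeasurableSet (C t))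
    (ht : t ≤ T) :
    ∀ᵐ s ∂filterLaw C p q x t, s.1 = 0 ∨ ∑ i, s.2.1 i = 1 := by
  classical
  have hinit : ∑ _i : Fin N, (N : ℝ≥0)⁻¹ = 1 := by
    rw [Finset.sum_const, Finset.card_univ, Fintype.card_fin, nsmul_eq_mul]
    exact mul_inv_cancel₀ (by positivity)
  have hS : ∀ t, MeasurableSet {s : FilterState Z N t | s.1 = 0 ∨ ∑ i, s.2.1 i = 1} := fun t =>
    (measurable_fst (measurableSet_singleton 0)).union
      ((show Measurable fun s : FilterState Z N t => ∑ i, s.2.1 i by fun_prop)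
        (measurableSet_singleton 1))
  cases t with
  | zero =>
    rw [filterLaw, ae_dirac_iff (hS 0)]
    exact .inr hinit
  | succ t =>
    have hF : Measurable fun s : FilterState Z N (t + 1) =>
        if s.1 = 0 ∨ ∑ i, s.2.1 i = 1 then (0 : ℝ≥0∞) else 1 :=
      Measurable.ite (hS _) measurable_const measurable_const
    have h := lintegral_filterLaw_succ (C := C) (p := p) (q := q) (x := x) hC ht hF
    have h0 : ∀ (s : FilterState Z N t) (z : Fin N → Z),
        (reweight p q x t s z).1 = 0 ∨ ∑ i, (reweight p q x t s z).2.1 i = 1 := by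
      intro s z
      rw [reweight_fst, sum_reweight_weight]
      by_cases hz : increment p q x t s z = 0
      · simp [hz]
      · exact .inr (div_self hz)
    have h1 : ∀ (s : FilterState Z N t) (z : Fin N → Z),
        ∫⁻ s', (if s'.1 = 0 ∨ ∑ i, s'.2.1 i = 1 then (0 : ℝ≥0∞) else 1)
          ∂resample (C t) (reweight p q x t s z) = 0 := by
      intro s z
      rw [lintegral_resample_of_const (C t) (sum_reweight_weight_eq_zero_or p q x s z) hF,
        if_pos (h0 s z)]
      intro a
      rw [if_pos (h0 s z), if_pos (.inr hinit)]
    simp only [h1, lintegral_zero] at h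
    rw [lintegral_eq_zero_iff hF] at h
    filter_upwards [h] with s hs
    by_contra hc
    simp [hc] at hs

open Classical in
/-- The expected weighted sum of a function of the trajectories, normalized by the likelihood
estimate, is the unnormalized integral of this function over the support of the proposal. -/
theorem lintegral_weighted_filterLaw (hN : 0 < N) (hC : ∀ t, MeasurableSet (C t)) (ht : t ≤ T)
    {φ : (Fin t → Z) → ℝ≥0∞} (hφ : Measurable φ) :
    ∫⁻ s, (s.1 : ℝ≥0∞) * ∑ i, s.2.1 i * φ (s.2.2 i) ∂filterLaw C p q x t =
      ∫⁻ z, (if chainDensity (q.transition x) t z = 0 then 0 else p.joint x t z * φ z)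
        ∂Measure.pi fun _ : Fin t => μ := by
  induction t with
  | zero =>
    rw [filterLaw, lintegral_dirac' _ (by fun_prop), lintegral_pi_zero]
    simp only [SequentialModel.joint_eq, chainDensity_zero, one_ne_zero, if_false,
      ENNReal.coe_one, one_mul]
    rw [Finset.sum_const, Finset.card_univ, Fintype.card_fin, nsmul_eq_mul, ← mul_assoc]
    have hNN : (N : ℝ≥0∞) * (((N : ℝ≥0)⁻¹ : ℝ≥0) : ℝ≥0∞) = 1 := by
      have : (N : ℝ≥0) * (N : ℝ≥0)⁻¹ = 1 := mul_inv_cancel₀ (by positivity)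
      exact_mod_cast this
    rw [hNN, one_mul]
  | succ t ih =>
    have hp := p.measurable_transition x ht
    have hq := q.measurable_transition x ht
    have hjoint : ∀ s ≤ T, Measurable (p.joint x s) := fun s hs =>
      measurable_chainDensity fun r hr => p.measurable_transition x (by omega)
    have hqjoint : ∀ s ≤ T, Measurable (chainDensity (q.transition x) s) := fun s hs =>
      measurable_chainDensity fun r hr => q.measurable_transition x (by omega)
    -- Integrated over its last argument, this is the test function at time `t` to which the
    -- induction hypothesis applies. The case distinction reflects that a point with proposal
    -- density zero is never drawn.
    let ψ : (Fin t → Z) × Z → ℝ≥0∞ := fun a =>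
      if q.transition x t a.1 a.2 = 0 then 0 else p.transition x t a.1 a.2 * φ (concat a.1 a.2)
    have hψ : Measurable ψ := Measurable.ite (hq (measurableSet_singleton 0)) measurable_const
      (hp.coe_nnreal_ennreal.mul (hφ.comp measurable_concat))
    have hψ' : Measurable fun z => ∫⁻ z', ψ (z, z') ∂μ := hψ.lintegral_prod_right'
    rw [lintegral_filterLaw_succ hC ht (by fun_prop)]
    have hstep : ∀ s : FilterState Z N t,
        ∫⁻ z, ∫⁻ s', (s'.1 : ℝ≥0∞) * ∑ i, s'.2.1 i * φ (s'.2.2 i)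
          ∂resample (C t) (reweight p q x t s z) ∂proposalLaw q x t s.2.2 =
        s.1 * ∑ i, s.2.1 i * ∫⁻ z', ψ (s.2.2 i, z') ∂μ := by
      intro s
      have hw : ∀ z, ∫⁻ s', (s'.1 : ℝ≥0∞) * ∑ i, s'.2.1 i * φ (s'.2.2 i)
          ∂resample (C t) (reweight p q x t s z) =
          s.1 * ∑ i, s.2.1 i * ((incrementalWeight p q x t (s.2.2 i) (z i) : ℝ≥0∞) *
            φ (concat (s.2.2 i) (z i))) := by
        intro z
        rw [lintegral_resample_weighted hN _ (sum_reweight_weight_eq_zero_or p q x s z) hφ,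
          reweight_fst, ENNReal.coe_mul, mul_assoc, Finset.mul_sum]
        congr 1
        refine Finset.sum_congr rfl fun i _ => ?_
        rw [reweight_weight, reweight_trajectory, ← mul_assoc, ← mul_assoc, ← ENNReal.coe_mul,
          ← ENNReal.coe_mul]
        congr 2
        -- The factor gained by the estimate cancels the normalization of the weights. If it is
        -- zero, every summand of the increment is zero as well, so the division by zero does no
        -- harm.
        by_cases hz : increment p q x t s z = 0
        · rw [hz, zero_mul]
          exact ((Finset.sum_eq_zero_iff_of_nonneg fun _ _ => zero_le).1 hz i
            (Finset.mem_univ i)).symm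
        · exact mul_div_cancel₀ _ hz
      have hα : ∀ i, Measurable fun z' : Z =>
          (incrementalWeight p q x t (s.2.2 i) z' : ℝ≥0∞) * φ (concat (s.2.2 i) z') := fun i =>
        ((measurable_incrementalWeight p q x ht).comp measurable_prodMk_left).coe_nnreal_ennreal.mul
          (hφ.comp (measurable_concat.comp measurable_prodMk_left))
      have hα' : ∀ i, Measurable fun z : Fin N → Z =>
          (incrementalWeight p q x t (s.2.2 i) (z i) : ℝ≥0∞) * φ (concat (s.2.2 i) (z i)) :=
        fun i => (hα i).comp (measurable_pi_apply i)
      simp only [hw]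
      rw [lintegral_const_mul _ (Finset.measurable_fun_sum _ fun i _ => (hα' i).const_mul _),
        lintegral_finsetSum _ fun i _ => (hα' i).const_mul _]
      congr 1
      refine Finset.sum_congr rfl fun i _ => ?_
      rw [lintegral_const_mul _ (hα' i),
        lintegral_proposalLaw_eval q x ht s.2.2 i (hα i)]
      congr 1
      refine lintegral_congr fun z' => ?_
      simp only [ψ, incrementalWeight_eq]
      split_ifs with hz
      · simp [hz]
      · rw [← mul_assoc, ← ENNReal.coe_mul, mul_div_cancel₀ _ hz]
    simp only [hstep]
    rw [ih (by omega) hψ', lintegral_pi_succ μ]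
    · refine lintegral_congr fun z => ?_
      split_ifs with hz
      · simp [chainDensity_concat, hz]
      · rw [← lintegral_const_mul _ (f := fun z' => ψ (z, z')) (hψ.comp measurable_prodMk_left)]
        refine lintegral_congr fun z' => ?_
        simp only [ψ, SequentialModel.joint_eq, chainDensity_concat, mul_eq_zero, hz, false_or]
        split_ifs
        · rw [mul_zero]
        · rw [ENNReal.coe_mul, mul_assoc]
    · exact Measurable.ite (hqjoint _ ht (measurableSet_singleton 0)) measurable_const
        ((hjoint _ ht).coe_nnreal_ennreal.mul hφ)

/-- The weighted identity with test function 1. The inequality can be strict, because model mass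
where the proposal vanishes is not seen. -/
theorem lintegral_estimate_le (hN : 0 < N) (hC : ∀ t, MeasurableSet (C t)) (ht : t ≤ T) :
    ∫⁻ s, (s.1 : ℝ≥0∞) ∂filterLaw C p q x t ≤ p.evidence x t := by
  classical
  calc ∫⁻ s, (s.1 : ℝ≥0∞) ∂filterLaw C p q x t
      = ∫⁻ s, (s.1 : ℝ≥0∞) * ∑ i, (s.2.1 i : ℝ≥0∞) * 1 ∂filterLaw C p q x t := by
        refine lintegral_congr_ae ?_
        filter_upwards [ae_estimate_eq_zero_or_sum_weight hN hC ht] with s hs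
        rcases hs with hs | hs
        · simp only [hs, ENNReal.coe_zero, zero_mul]
        · simp only [mul_one, ← ENNReal.ofNNReal_finsetSum, hs, ENNReal.coe_one]
    _ = ∫⁻ z, (if chainDensity (q.transition x) t z = 0 then 0 else p.joint x t z * 1)
          ∂Measure.pi fun _ : Fin t => μ :=
        lintegral_weighted_filterLaw hN hC ht (φ := fun _ => 1) measurable_const
    _ ≤ p.evidence x t := lintegral_mono fun z => by
        simp only [mul_one]
        split_ifs
        · exact zero_le
        · exact le_rfl

/-- A set of trajectories which is negligible for the model contains almost surely no particle of
nonzero weight, as long as the likelihood estimate does not vanish. -/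
theorem ae_weight_eq_zero_of_joint (hN : 0 < N) (hC : ∀ t, MeasurableSet (C t)) (ht : t ≤ T)
    {B : Set (Fin t → Z)} (hB : MeasurableSet B)
    (h : ∀ᵐ z ∂Measure.pi fun _ : Fin t => μ, z ∈ B → p.joint x t z = 0) :
    ∀ᵐ s ∂filterLaw C p q x t, s.1 ≠ 0 → ∀ i, s.2.1 i ≠ 0 → s.2.2 i ∉ B := by
  classical
  have hi : Measurable (B.indicator (1 : (Fin t → Z) → ℝ≥0∞)) := measurable_one.indicator hB
  -- With the indicator of `B` as test function the integral over trajectories is zero, hence so is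
  -- the integrand over filter states.
  have h0 := lintegral_weighted_filterLaw (p := p) (q := q) (x := x) hN hC ht hi
  rw [lintegral_congr_ae (μ := Measure.pi _) (g := fun _ => 0), lintegral_zero,
    lintegral_eq_zero_iff (by fun_prop)] at h0
  · filter_upwards [h0] with s hs hs1 i hsi hiB
    simp only [Pi.zero_apply, mul_eq_zero, ENNReal.coe_eq_zero, hs1, false_or,
      Finset.sum_eq_zero_iff, Finset.mem_univ, true_implies] at hs
    simpa [hiB, hsi] using hs i
  · filter_upwards [h] with z hz
    by_cases hzB : z ∈ B
    · simp [hz hzB]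
    · simp [hzB]

/-- Converse of `ae_weight_eq_zero_of_joint` on the support of the proposal. -/
theorem joint_eq_zero_of_ae_weight (hN : 0 < N) (hC : ∀ t, MeasurableSet (C t)) (ht : t ≤ T)
    {B : Set (Fin t → Z)} (hB : MeasurableSet B)
    (h : ∀ᵐ s ∂filterLaw C p q x t, ∀ i, s.2.1 i ≠ 0 → s.2.2 i ∉ B) :
    ∀ᵐ z ∂Measure.pi fun _ : Fin t => μ,
      z ∈ B → chainDensity (q.transition x) t z ≠ 0 → p.joint x t z = 0 := by
  classical
  have hi : Measurable (B.indicator (1 : (Fin t → Z) → ℝ≥0∞)) := measurable_one.indicator hB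
  have h0 := lintegral_weighted_filterLaw (p := p) (q := q) (x := x) hN hC ht hi
  have hjoint : Measurable (p.joint x t) :=
    measurable_chainDensity fun r hr => p.measurable_transition x (by omega)
  have hqjoint : Measurable (chainDensity (q.transition x) t) :=
    measurable_chainDensity fun r hr => q.measurable_transition x (by omega)
  have hm : Measurable fun z => if chainDensity (q.transition x) t z = 0 then (0 : ℝ≥0∞) else
      p.joint x t z * B.indicator (1 : (Fin t → Z) → ℝ≥0∞) z :=
    Measurable.ite (hqjoint (measurableSet_singleton 0)) measurable_const
      (hjoint.coe_nnreal_ennreal.mul hi)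
  rw [lintegral_congr_ae (g := fun _ => 0), lintegral_zero, eq_comm,
    lintegral_eq_zero_iff hm] at h0
  · filter_upwards [h0] with z hz hzB hzq
    simpa [hzB, hzq] using hz
  · filter_upwards [h] with s hs
    have : ∑ i, (s.2.1 i : ℝ≥0∞) * B.indicator (1 : (Fin t → Z) → ℝ≥0∞) (s.2.2 i) = 0 := by
      refine Finset.sum_eq_zero fun i _ => ?_
      by_cases hsi : s.2.1 i = 0
      · simp [hsi]
      · simp [hs i hsi]
    rw [this, mul_zero]

end FilterLaw

/-! ### Exact estimates and proposals proportional to the model -/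

section Matching

variable {X Z : Type*} [MeasurableSpace X] [MeasurableSpace Z]
  {ν : Measure X} {μ : Measure Z} {T N : ℕ}

/-- The trajectories at which the transition density of the model is almost everywhere the multiple
`c` of the proposal density. -/
def matchSet (p : SequentialModel ν μ T) (q : Proposal X μ T) (x : ℕ → X) (t : ℕ) (c : ℝ≥0) :
    Set (Fin t → Z) :=
  {z | ∀ᵐ z' ∂μ, p.transition x t z z' = c * q.transition x t z z'}

/-- The model has positive finite evidence `e t` for the first `t` observations, and the predictive
density of the next observation is almost everywhere independent of the latents. -/
structure HasConstantPrediction (p : SequentialModel ν μ T) (x : ℕ → X) (e : ℕ → ℝ≥0) : Prop where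
  evidence_eq : ∀ t ≤ T, p.evidence x t = e t
  ne_zero : ∀ t ≤ T, e t ≠ 0
  lintegral_transition : ∀ t < T, ∀ᵐ z ∂Measure.pi fun _ : Fin t => μ, p.joint x t z ≠ 0 →
    ∫⁻ z', (p.transition x t z z' : ℝ≥0∞) ∂μ = (e (t + 1) / e t : ℝ≥0)

theorem evidence_zero (p : SequentialModel ν μ T) (x : ℕ → X) : p.evidence x 0 = 1 := by
  rw [SequentialModel.evidence, lintegral_pi_zero, SequentialModel.joint_eq, chainDensity_zero,
    ENNReal.coe_one]

variable {p : SequentialModel ν μ T} {q : Proposal X μ T} {x : ℕ → X} {e : ℕ → ℝ≥0} {t : ℕ}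

theorem HasConstantPrediction.apply_zero (h : HasConstantPrediction p x e) : e 0 = 1 := by
  have := h.evidence_eq 0 (Nat.zero_le _)
  rw [evidence_zero] at this
  exact_mod_cast this.symm

theorem HasConstantPrediction.mul_div (h : HasConstantPrediction p x e) (ht : t < T) :
    e t * (e (t + 1) / e t) = e (t + 1) :=
  mul_div_cancel₀ _ (h.ne_zero t ht.le)

theorem SequentialModel.measurable_joint (p : SequentialModel ν μ T) (x : ℕ → X) (ht : t ≤ T) :
    Measurable (p.joint x t) :=
  measurable_chainDensity fun r hr => p.measurable_transition x (by omega)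

theorem Proposal.measurable_chainDensity (q : Proposal X μ T) (x : ℕ → X) (ht : t ≤ T) :
    Measurable (chainDensity (q.transition x) t) :=
  _root_.measurable_chainDensity fun r hr => q.measurable_transition x (by omega)

theorem SequentialModel.joint_concat (p : SequentialModel ν μ T) (x : ℕ → X) (z : Fin t → Z)
    (z' : Z) : p.joint x (t + 1) (concat z z') = p.joint x t z * p.transition x t z z' :=
  chainDensity_concat (p.transition x) z z'

theorem ae_withDensity_transition_iff (q : Proposal X μ T) (x : ℕ → X) (ht : t < T)
    (zs : Fin t → Z) {P : Z → Prop} :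
    (∀ᵐ z ∂μ.withDensity fun z => (q.transition x t zs z : ℝ≥0∞), P z) ↔
      ∀ᵐ z ∂μ, q.transition x t zs z ≠ 0 → P z := by
  have hq : Measurable fun z => (q.transition x t zs z : ℝ≥0∞) :=
    ((q.measurable_transition x ht).comp measurable_prodMk_left).coe_nnreal_ennreal
  rw [ae_withDensity_iff hq]
  simp

theorem lintegral_incrementalWeight_le (p : SequentialModel ν μ T) (q : Proposal X μ T) (x : ℕ → X)
    (ht : t < T) (zs : Fin t → Z) :
    ∫⁻ z, (incrementalWeight p q x t zs z : ℝ≥0∞)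
      ∂μ.withDensity (fun z => (q.transition x t zs z : ℝ≥0∞)) ≤
      ∫⁻ z, (p.transition x t zs z : ℝ≥0∞) ∂μ := by
  have hq : Measurable fun z => (q.transition x t zs z : ℝ≥0∞) :=
    ((q.measurable_transition x ht).comp measurable_prodMk_left).coe_nnreal_ennreal
  have hw : Measurable fun z => (incrementalWeight p q x t zs z : ℝ≥0∞) :=
    ((measurable_incrementalWeight p q x ht).comp measurable_prodMk_left).coe_nnreal_ennreal
  rw [lintegral_withDensity_eq_lintegral_mul _ hq hw]
  refine lintegral_mono fun z => ?_
  rw [Pi.mul_apply, ← ENNReal.coe_mul, incrementalWeight_eq, ENNReal.coe_le_coe]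
  by_cases hz : q.transition x t zs z = 0
  · simp [hz]
  · rw [mul_div_cancel₀ _ hz]

/-- The weights only give information where the proposal is positive, which yields `c * q ≤ p`
almost everywhere for the two transition densities. Both sides have integral `c`, so they agree also
where the proposal vanishes. -/
theorem mem_matchSet_of_ae_incrementalWeight (ht : t < T) {zs : Fin t → Z} {c : ℝ≥0}
    (hg : ∫⁻ z', (p.transition x t zs z' : ℝ≥0∞) ∂μ = c)
    (hw : ∀ᵐ z' ∂μ.withDensity fun z => (q.transition x t zs z : ℝ≥0∞),
      incrementalWeight p q x t zs z' = c) :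
    zs ∈ matchSet p q x t c := by
  rw [ae_withDensity_transition_iff q x ht] at hw
  have hp : Measurable fun z' => (p.transition x t zs z' : ℝ≥0∞) :=
    ((p.measurable_transition x ht).comp measurable_prodMk_left).coe_nnreal_ennreal
  have hq : Measurable fun z' => (q.transition x t zs z' : ℝ≥0∞) :=
    ((q.measurable_transition x ht).comp measurable_prodMk_left).coe_nnreal_ennreal
  have hint : ∫⁻ z', (c : ℝ≥0∞) * q.transition x t zs z' ∂μ = c := by
    rw [lintegral_const_mul _ hq, q.lintegral_transition x ht, mul_one]
  have hle : ∀ᵐ z' ∂μ, (c : ℝ≥0∞) * q.transition x t zs z' ≤ p.transition x t zs z' := by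
    filter_upwards [hw] with z' hz'
    by_cases h0 : q.transition x t zs z' = 0
    · simp [h0]
    · rw [← hz' h0, incrementalWeight_eq, ← ENNReal.coe_mul, div_mul_cancel₀ _ h0]
  have heq := ae_eq_of_ae_le_of_lintegral_le hle (by rw [hint]; exact ENNReal.coe_ne_top)
    hp.aemeasurable (by rw [hint, hg])
  refine Filter.Eventually.mono heq fun z' hz' => ?_
  simp only [← ENNReal.coe_mul, ENNReal.coe_inj] at hz'
  exact hz'.symm

variable [SigmaFinite μ]

theorem measurableSet_matchSet (ht : t < T) (c : ℝ≥0) : MeasurableSet (matchSet p q x t c) :=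
  measurableSet_ae μ (S := {a | p.transition x t a.1 a.2 = c * q.transition x t a.1 a.2})
    (measurableSet_eq_fun (p.measurable_transition x ht)
      ((q.measurable_transition x ht).const_mul c))

theorem measurable_lintegral_transition (p : SequentialModel ν μ T) (x : ℕ → X) (ht : t < T) :
    Measurable fun z => ∫⁻ z', (p.transition x t z z' : ℝ≥0∞) ∂μ :=
  (p.measurable_transition x ht).coe_nnreal_ennreal.lintegral_prod_right'

theorem ae_joint_succ_iff (ht : t < T) (c : ℝ≥0) :
    (∀ᵐ z ∂Measure.pi fun _ : Fin (t + 1) => μ,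
      p.joint x (t + 1) z = c * chainDensity (q.transition x) (t + 1) z) ↔
    ∀ᵐ z ∂Measure.pi fun _ : Fin t => μ, ∀ᵐ z' ∂μ,
      p.joint x t z * p.transition x t z z' =
        c * (chainDensity (q.transition x) t z * q.transition x t z z') := by
  rw [ae_pi_succ μ (measurableSet_eq_fun (p.measurable_joint x ht)
    ((q.measurable_chainDensity x ht).const_mul c))]
  simp only [SequentialModel.joint_concat, chainDensity_concat]

/-- Integrating out the last latent turns the proposal transition into 1 and the model transition
into the constant prediction. -/
theorem HasConstantPrediction.ae_joint_eq_of_succ (h : HasConstantPrediction p x e) (ht : t < T)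
    (hs : ∀ᵐ z ∂Measure.pi fun _ : Fin (t + 1) => μ,
      p.joint x (t + 1) z = e (t + 1) * chainDensity (q.transition x) (t + 1) z) :
    ∀ᵐ z ∂Measure.pi fun _ : Fin t => μ,
      p.joint x t z = e t * chainDensity (q.transition x) t z := by
  rw [ae_joint_succ_iff ht] at hs
  filter_upwards [hs, h.lintegral_transition t ht] with z hz hg
  have hp : Measurable fun z' => (p.transition x t z z' : ℝ≥0∞) :=
    ((p.measurable_transition x ht).comp measurable_prodMk_left).coe_nnreal_ennreal
  have hq : Measurable fun z' => (q.transition x t z z' : ℝ≥0∞) :=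
    ((q.measurable_transition x ht).comp measurable_prodMk_left).coe_nnreal_ennreal
  have hint : (p.joint x t z : ℝ≥0∞) * ∫⁻ z', (p.transition x t z z' : ℝ≥0∞) ∂μ =
      (e (t + 1) * chainDensity (q.transition x) t z : ℝ≥0) := by
    calc (p.joint x t z : ℝ≥0∞) * ∫⁻ z', (p.transition x t z z' : ℝ≥0∞) ∂μ
        = ∫⁻ z', (p.joint x t z : ℝ≥0∞) * p.transition x t z z' ∂μ :=
          (lintegral_const_mul _ hp).symm
      _ = ∫⁻ z', ((e (t + 1) * chainDensity (q.transition x) t z : ℝ≥0) : ℝ≥0∞) *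
            q.transition x t z z' ∂μ := by
          refine lintegral_congr_ae (hz.mono fun z' h' => ?_)
          simp only [← ENNReal.coe_mul, h', mul_assoc]
      _ = _ := by
          rw [lintegral_const_mul _ hq, q.lintegral_transition x ht, mul_one]
  by_cases h0 : p.joint x t z = 0
  · rw [h0, ENNReal.coe_zero, zero_mul, eq_comm, ENNReal.coe_eq_zero, mul_eq_zero] at hint
    rw [h0, hint.resolve_left (h.ne_zero _ ht), mul_zero]
  · rw [hg h0, ← ENNReal.coe_mul, ENNReal.coe_inj] at hint
    have h1 := h.ne_zero (t + 1) ht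
    have h2 := h.ne_zero t ht.le
    field_simp at hint
    exact hint

theorem HasConstantPrediction.ae_joint_eq (h : HasConstantPrediction p x e) (ht : t ≤ T)
    (hT : ∀ᵐ z ∂Measure.pi fun _ : Fin T => μ,
      p.joint x T z = e T * chainDensity (q.transition x) T z) :
    ∀ᵐ z ∂Measure.pi fun _ : Fin t => μ,
      p.joint x t z = e t * chainDensity (q.transition x) t z :=
  Nat.decreasingInduction (motive := fun t _ => ∀ᵐ z ∂Measure.pi fun _ : Fin t => μ,
      p.joint x t z = e t * chainDensity (q.transition x) t z)
    (fun _ ht hs => h.ae_joint_eq_of_succ ht hs) hT ht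

theorem HasConstantPrediction.ae_mem_matchSet (h : HasConstantPrediction p x e) (ht : t < T)
    (hT : ∀ᵐ z ∂Measure.pi fun _ : Fin T => μ,
      p.joint x T z = e T * chainDensity (q.transition x) T z) :
    ∀ᵐ z ∂Measure.pi fun _ : Fin t => μ, p.joint x t z ≠ 0 →
      z ∈ matchSet p q x t (e (t + 1) / e t) := by
  filter_upwards [h.ae_joint_eq ht.le hT, (ae_joint_succ_iff ht _).1 (h.ae_joint_eq ht hT)]
    with z hz hz' h0
  refine hz'.mono fun z' hzz => ?_
  have h2 := h.ne_zero t ht.le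
  have hq0 : chainDensity (q.transition x) t z ≠ 0 := fun hq => h0 (by rw [hz, hq, mul_zero])
  rw [hz] at hzz
  apply mul_left_cancel₀ (mul_ne_zero h2 hq0)
  rw [hzz]
  field_simp

/-- Matching is needed only on the support of the proposal: the induction hypothesis makes the model
density vanish wherever the proposal density does. -/
theorem HasConstantPrediction.ae_joint_eq_of_matchSet (h : HasConstantPrediction p x e)
    (hm : ∀ t < T, ∀ᵐ z ∂Measure.pi fun _ : Fin t => μ, p.joint x t z ≠ 0 →
      chainDensity (q.transition x) t z ≠ 0 → z ∈ matchSet p q x t (e (t + 1) / e t))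
    (ht : t ≤ T) :
    ∀ᵐ z ∂Measure.pi fun _ : Fin t => μ,
      p.joint x t z = e t * chainDensity (q.transition x) t z := by
  induction t with
  | zero =>
    refine .of_forall fun z => ?_
    rw [h.apply_zero, SequentialModel.joint_eq, chainDensity_zero, chainDensity_zero, mul_one]
  | succ t ih =>
    rw [ae_joint_succ_iff ht]
    filter_upwards [ih (by omega), hm t ht] with z hz hmz
    have h2 := h.ne_zero t (by omega)
    by_cases hq : chainDensity (q.transition x) t z = 0
    · refine .of_forall fun z' => ?_
      rw [hz, hq]
      simp
    · refine Filter.Eventually.mono (hmz (by rw [hz]; exact mul_ne_zero h2 hq) hq) fun z' hz' => ?_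
      rw [hz, hz']
      field_simp

variable {C : ℕ → Set (Fin N → ℝ≥0)}

theorem HasConstantPrediction.ae_estimate_eq_of_matchSet (h : HasConstantPrediction p x e)
    (hN : 0 < N) (hC : ∀ t, MeasurableSet (C t))
    (hm : ∀ t < T, ∀ᵐ z ∂Measure.pi fun _ : Fin t => μ, p.joint x t z ≠ 0 →
      z ∈ matchSet p q x t (e (t + 1) / e t)) (ht : t ≤ T) :
    ∀ᵐ s ∂filterLaw C p q x t, s.1 = e t := by
  induction t with
  | zero =>
    have hS : MeasurableSet {s : FilterState Z N 0 | s.1 = e 0} :=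
      measurable_fst (measurableSet_singleton _)
    rw [filterLaw, ae_dirac_iff hS]
    exact h.apply_zero.symm
  | succ t ih =>
    rw [ae_estimate_filterLaw_succ hC ht]
    -- Trajectories outside the matching set are negligible for the model, so almost surely no
    -- particle with positive weight is there.
    have hB := ae_weight_eq_zero_of_joint (q := q) hN hC (by omega : t ≤ T)
      (measurableSet_matchSet (q := q) ht (e (t + 1) / e t)).compl
      ((hm t ht).mono fun z hz hzm => by_contra fun h0 => hzm (hz h0))
    filter_upwards [ih (by omega), ae_estimate_eq_zero_or_sum_weight hN hC (by omega : t ≤ T), hB]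
      with s hs hsum hsB
    have h0 : s.1 ≠ 0 := hs ▸ h.ne_zero t (by omega)
    have := fun i => q.isProbabilityMeasure x ht (s.2.2 i)
    have hall : ∀ᵐ z ∂proposalLaw q x t s.2.2, ∀ i, s.2.1 i ≠ 0 →
        incrementalWeight p q x t (s.2.2 i) (z i) = e (t + 1) / e t := by
      refine ae_all_iff.2 fun i => ?_
      by_cases hi : s.2.1 i = 0
      · exact .of_forall fun z hz => absurd hi hz
      have hmi : s.2.2 i ∈ matchSet p q x t (e (t + 1) / e t) := not_not.1 (hsB h0 i hi)
      have hwi : ∀ᵐ z' ∂μ.withDensity fun z => (q.transition x t (s.2.2 i) z : ℝ≥0∞),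
          incrementalWeight p q x t (s.2.2 i) z' = e (t + 1) / e t := by
        rw [ae_withDensity_transition_iff q x ht]
        refine Filter.Eventually.mono hmi fun z' hz' hq => ?_
        rw [incrementalWeight_eq, hz', mul_div_cancel_right₀ _ hq]
      rw [proposalLaw_eq]
      exact ((measurePreserving_eval (fun i => μ.withDensity fun z =>
        (q.transition x t (s.2.2 i) z : ℝ≥0∞)) i).quasiMeasurePreserving.ae hwi).mono
        fun z hz _ => hz
    filter_upwards [hall] with z hz
    have hinc : increment p q x t s z = ∑ i, s.2.1 i * (e (t + 1) / e t) := by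
      refine Finset.sum_congr rfl fun i _ => ?_
      by_cases hi : s.2.1 i = 0
      · simp [hi]
      · rw [hz i hi]
    rw [hinc, ← Finset.sum_mul, hsum.resolve_left h0, one_mul, hs, h.mul_div ht]

theorem HasConstantPrediction.ae_lintegral_transition_eq (h : HasConstantPrediction p x e)
    (hN : 0 < N) (hC : ∀ t, MeasurableSet (C t)) (ht : t < T) :
    ∀ᵐ s ∂filterLaw C p q x t, s.1 ≠ 0 → ∀ i, s.2.1 i ≠ 0 →
      ∫⁻ z', (p.transition x t (s.2.2 i) z' : ℝ≥0∞) ∂μ = (e (t + 1) / e t : ℝ≥0) := by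
  have hB := ae_weight_eq_zero_of_joint (q := q) hN hC ht.le
    ((measurable_lintegral_transition p x ht)
      (measurableSet_singleton ((e (t + 1) / e t : ℝ≥0) : ℝ≥0∞))).compl
    ((h.lintegral_transition t ht).mono fun z hz hzm => by_contra fun h0 => hzm (hz h0))
  filter_upwards [hB] with s hs h0 i hi
  exact not_not.1 (hs h0 i hi)

theorem HasConstantPrediction.ae_estimate_eq_of_succ (h : HasConstantPrediction p x e)
    (hN : 0 < N) (hC : ∀ t, MeasurableSet (C t)) (ht : t < T)
    (hs : ∀ᵐ s ∂filterLaw C p q x (t + 1), s.1 = e (t + 1)) :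
    ∀ᵐ s ∂filterLaw C p q x t, s.1 = e t := by
  have := isProbabilityMeasure_filterLaw (p := p) (q := q) (x := x) hC ht.le
  rw [ae_estimate_filterLaw_succ hC ht] at hs
  -- Averaging over the new latents alone: the next estimate is the constant `e (t + 1)`, while its
  -- conditional mean is at most `s.1 * (e (t + 1) / e t)`.
  have hge : ∀ᵐ s ∂filterLaw C p q x t, (e t : ℝ≥0∞) ≤ s.1 := by
    filter_upwards [hs, ae_estimate_eq_zero_or_sum_weight hN hC ht.le,
      h.ae_lintegral_transition_eq hN hC ht] with s hs hsum hg
    have := isProbabilityMeasure_proposalLaw q x ht s.2.2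
    have hPi := fun i => q.isProbabilityMeasure x ht (s.2.2 i)
    have h0 : s.1 ≠ 0 := by
      intro h0
      obtain ⟨z, hz⟩ := hs.exists
      rw [h0, zero_mul] at hz
      exact h.ne_zero _ ht hz.symm
    have hα : ∀ i, Measurable fun z' : Z => (incrementalWeight p q x t (s.2.2 i) z' : ℝ≥0∞) :=
      fun i => ((measurable_incrementalWeight p q x ht).comp
        measurable_prodMk_left).coe_nnreal_ennreal
    have hα' : ∀ i, Measurable fun z : Fin N → Z =>
        (incrementalWeight p q x t (s.2.2 i) (z i) : ℝ≥0∞) :=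
      fun i => (hα i).comp (measurable_pi_apply i)
    have hmean : ∫⁻ z, (increment p q x t s z : ℝ≥0∞) ∂proposalLaw q x t s.2.2 ≤
        (e (t + 1) / e t : ℝ≥0) := by
      calc ∫⁻ z, (increment p q x t s z : ℝ≥0∞) ∂proposalLaw q x t s.2.2
          = ∑ i, (s.2.1 i : ℝ≥0∞) * ∫⁻ z, (incrementalWeight p q x t (s.2.2 i) (z i) : ℝ≥0∞)
              ∂proposalLaw q x t s.2.2 := by
            simp only [increment, ENNReal.ofNNReal_finsetSum, ENNReal.coe_mul]
            rw [lintegral_finsetSum _ fun i _ => (hα' i).const_mul _]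
            exact Finset.sum_congr rfl fun i _ => lintegral_const_mul _ (hα' i)
        _ ≤ ∑ i, (s.2.1 i : ℝ≥0∞) * (e (t + 1) / e t : ℝ≥0) := by
            refine Finset.sum_le_sum fun i _ => ?_
            by_cases hi : s.2.1 i = 0
            · simp [hi]
            rw [← hg h0 i hi, proposalLaw_eq, (measurePreserving_eval (fun i =>
              μ.withDensity fun z => (q.transition x t (s.2.2 i) z : ℝ≥0∞)) i).lintegral_comp
              (hα i)]
            refine mul_le_mul' le_rfl ?_
            exact lintegral_incrementalWeight_le p q x ht _
        _ = (e (t + 1) / e t : ℝ≥0) := by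
            rw [← Finset.sum_mul, ← ENNReal.ofNNReal_finsetSum, hsum.resolve_left h0,
              ENNReal.coe_one, one_mul]
    have hle : (e (t + 1) : ℝ≥0∞) ≤ s.1 * (e (t + 1) / e t : ℝ≥0) := by
      calc (e (t + 1) : ℝ≥0∞) = ∫⁻ _, (e (t + 1) : ℝ≥0∞) ∂proposalLaw q x t s.2.2 := by simp
        _ = ∫⁻ z, (s.1 : ℝ≥0∞) * increment p q x t s z ∂proposalLaw q x t s.2.2 :=
            lintegral_congr_ae (hs.mono fun z hz => by simp only [← hz, ENNReal.coe_mul])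
        _ = s.1 * ∫⁻ z, (increment p q x t s z : ℝ≥0∞) ∂proposalLaw q x t s.2.2 :=
            lintegral_const_mul _
              ((measurable_increment ht).comp measurable_prodMk_left).coe_nnreal_ennreal
        _ ≤ _ := by gcongr
    rw [← ENNReal.coe_mul, ENNReal.coe_le_coe, mul_div_assoc',
      le_div_iff₀ (pos_iff_ne_zero.2 (h.ne_zero t ht.le)), mul_comm] at hle
    exact_mod_cast le_of_mul_le_mul_right hle (pos_iff_ne_zero.2 (h.ne_zero _ ht))
  -- The estimate is at least `e t` and has mean at most `e t`.
  have heq := ae_eq_of_ae_le_of_lintegral_le hge (by simp) (by fun_prop)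
    (by simpa [h.evidence_eq t ht.le] using
      lintegral_estimate_le (p := p) (q := q) (x := x) hN hC ht.le)
  filter_upwards [heq] with s hs
  exact_mod_cast hs.symm

theorem HasConstantPrediction.ae_estimate_eq (h : HasConstantPrediction p x e)
    (hN : 0 < N) (hC : ∀ t, MeasurableSet (C t)) (ht : t ≤ T)
    (hT : ∀ᵐ s ∂filterLaw C p q x T, s.1 = e T) :
    ∀ᵐ s ∂filterLaw C p q x t, s.1 = e t :=
  Nat.decreasingInduction (motive := fun t _ => ∀ᵐ s ∂filterLaw C p q x t, s.1 = e t)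
    (fun _ ht hs => h.ae_estimate_eq_of_succ hN hC ht hs) hT ht

theorem HasConstantPrediction.ae_mem_matchSet_of_estimate (h : HasConstantPrediction p x e)
    (hN : 0 < N) (hC : ∀ t, MeasurableSet (C t)) (ht : t < T)
    (hT : ∀ᵐ s ∂filterLaw C p q x T, s.1 = e T) :
    ∀ᵐ z ∂Measure.pi fun _ : Fin t => μ, p.joint x t z ≠ 0 →
      chainDensity (q.transition x) t z ≠ 0 → z ∈ matchSet p q x t (e (t + 1) / e t) := by
  have hall : ∀ᵐ s ∂filterLaw C p q x t, ∀ i, s.2.1 i ≠ 0 →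
      s.2.2 i ∉ (matchSet p q x t (e (t + 1) / e t))ᶜ := by
    filter_upwards [h.ae_estimate_eq hN hC ht.le hT,
      (ae_estimate_filterLaw_succ hC ht _).1 (h.ae_estimate_eq hN hC ht hT),
      ae_estimate_eq_zero_or_sum_weight hN hC ht.le, h.ae_lintegral_transition_eq hN hC ht]
      with s hs hsucc hsum hg i hi
    have h0 : s.1 ≠ 0 := hs ▸ h.ne_zero t ht.le
    have := fun i => q.isProbabilityMeasure x ht (s.2.2 i)
    rw [Set.notMem_compl_iff]
    refine mem_matchSet_of_ae_incrementalWeight ht (hg h0 i hi) ?_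
    -- Given the state, the particles move independently, and dividing the estimate at `t + 1` by
    -- the one at `t` shows that their weighted sum of incremental weights is constant.
    refine ae_eq_of_ae_weighted_sum_eq (fun i => μ.withDensity fun z =>
        (q.transition x t (s.2.2 i) z : ℝ≥0∞))
      (f := fun i => incrementalWeight p q x t (s.2.2 i)) (w := s.2.1)
      (fun i => (measurable_incrementalWeight p q x ht).comp measurable_prodMk_left)
      (hsum.resolve_left h0).le
      (fun j hj => (lintegral_incrementalWeight_le p q x ht _).trans (hg h0 j hj).le) ?_ i hi
    rw [proposalLaw_eq] at hsucc
    filter_upwards [hsucc] with z hz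
    rw [eq_div_iff (h.ne_zero t ht.le), mul_comm, ← hs]
    exact hz
  filter_upwards [joint_eq_zero_of_ae_weight hN hC ht.le
    (measurableSet_matchSet (q := q) ht (e (t + 1) / e t)).compl hall] with z hz hz0 hzq
  by_contra hmem
  exact hz0 (hz hmem hzq)

/-- The estimate of the particle filter is almost surely exact if and only if the proposal is the
posterior. -/
theorem HasConstantPrediction.ae_estimate_eq_iff (h : HasConstantPrediction p x e)
    (hN : 0 < N) (hC : ∀ t, MeasurableSet (C t)) :
    (∀ᵐ s ∂filterLaw C p q x T, s.1 = e T) ↔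
      ∀ᵐ z ∂Measure.pi fun _ : Fin T => μ, (q.joint x z : ℝ≥0∞) = p.posterior x T z := by
  have hpost : (∀ᵐ z ∂Measure.pi fun _ : Fin T => μ, (q.joint x z : ℝ≥0∞) = p.posterior x T z) ↔
      ∀ᵐ z ∂Measure.pi fun _ : Fin T => μ,
        p.joint x T z = e T * chainDensity (q.transition x) T z := by
    refine Filter.eventually_congr (.of_forall fun z => ?_)
    have h0 := h.ne_zero T le_rfl
    rw [SequentialModel.posterior, h.evidence_eq T le_rfl, ← ENNReal.coe_div h0, ENNReal.coe_inj,
      q.joint_eq, eq_div_iff h0, mul_comm, eq_comm]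
  rw [hpost]
  exact ⟨fun hT => h.ae_joint_eq_of_matchSet
      (fun t ht => h.ae_mem_matchSet_of_estimate hN hC ht hT) le_rfl,
    fun hT => h.ae_estimate_eq_of_matchSet hN hC (fun t ht => h.ae_mem_matchSet ht hT) le_rfl⟩

theorem HasConstantPrediction.fivo_le (h : HasConstantPrediction p x e)
    (hN : 0 < N) (hC : ∀ t, MeasurableSet (C t)) :
    fivo C p x q ≤ ENNReal.log (e T) ∧
      (fivo C p x q = ENNReal.log (e T) ↔ ∀ᵐ s ∂filterLaw C p q x T, s.1 = e T) := by
  have := isProbabilityMeasure_filterLaw (p := p) (q := q) (x := x) hC le_rfl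
  have hle := extendedExpectation_log_le (P := filterLaw C p q x T) measurable_fst
    (h.ne_zero T le_rfl)
    ((lintegral_estimate_le hN hC le_rfl).trans (h.evidence_eq T le_rfl).le)
  refine ⟨hle.1, hle.2, fun hae => ?_⟩
  unfold fivo
  rw [extendedExpectation_congr_ae (g := fun _ => ENNReal.log (e T))
    (hae.mono fun s hs => by simp only [hs]), extendedExpectation_const]

end Matching

/-! ### A proposal that matches the model -/

section Existence

theorem lintegral_div_toNNReal_eq_one {Z : Type*} [MeasurableSpace Z] {μ : Measure Z} {f : Z → ℝ≥0}
    (hf : Measurable f) (h0 : ∫⁻ z, (f z : ℝ≥0∞) ∂μ ≠ 0) (h1 : ∫⁻ z, (f z : ℝ≥0∞) ∂μ ≠ ∞) :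
    ∫⁻ z, ((f z / (∫⁻ z, (f z : ℝ≥0∞) ∂μ).toNNReal : ℝ≥0) : ℝ≥0∞) ∂μ = 1 := by
  lift ∫⁻ z, (f z : ℝ≥0∞) ∂μ to ℝ≥0 using h1 with m hm
  have hm0 : m ≠ 0 := by simpa using h0
  simp only [ENNReal.toNNReal_coe, ENNReal.coe_div hm0]
  simp only [div_eq_mul_inv]
  rw [lintegral_mul_const _ hf.coe_nnreal_ennreal, ← hm]
  exact ENNReal.mul_inv_cancel h0 ENNReal.coe_ne_top

/-- Supplies the fallback density: a proposal must be normalized for all arguments, including those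
where the model transition has integral zero or infinity. -/
theorem exists_lintegral_eq_one {Z : Type*} [MeasurableSpace Z] (μ : Measure Z) [SigmaFinite μ]
    [NeZero μ] : ∃ f : Z → ℝ≥0, Measurable f ∧ ∫⁻ z, (f z : ℝ≥0∞) ∂μ = 1 := by
  obtain ⟨g, hg0, hg, hg1⟩ := exists_pos_lintegral_lt_of_sigmaFinite μ one_ne_zero
  refine ⟨_, hg.div_const _, lintegral_div_toNNReal_eq_one hg ?_ (hg1.trans ENNReal.one_lt_top).ne⟩
  rw [Ne, lintegral_eq_zero_iff hg.coe_nnreal_ennreal]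
  intro h
  obtain ⟨z, hz⟩ := h.exists
  exact (hg0 z).ne' (by simpa using hz)

variable {X Z : Type*} [MeasurableSpace X] [MeasurableSpace Z]
  {ν : Measure X} {μ : Measure Z} {T : ℕ}

/-- The predictive density of the last of `t + 1` observations given the previous latents. -/
noncomputable def SequentialModel.predictive (p : SequentialModel ν μ T) (t : ℕ)
    (xs : Fin (t + 1) → X) (zs : Fin t → Z) : ℝ≥0∞ :=
  ∫⁻ z, (p.dens t (fun i => xs i.castSucc) zs (xs (Fin.last t)) z : ℝ≥0∞) ∂μ

open Classical in
/-- The variational posterior proportional to the transition densities of the model, where these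
can be normalized, and equal to `ρ` elsewhere. -/
noncomputable def SequentialModel.normalized [SigmaFinite μ] (p : SequentialModel ν μ T) (ρ : Z → ℝ≥0)
    (hρ : Measurable ρ) (hρ1 : ∫⁻ z, (ρ z : ℝ≥0∞) ∂μ = 1) : Proposal X μ T where
  dens t xs zs z :=
    if p.predictive t xs zs = 0 ∨ p.predictive t xs zs = ∞ then ρ z
    else p.dens t (fun i => xs i.castSucc) zs (xs (Fin.last t)) z / (p.predictive t xs zs).toNNReal
  measurable_dens t ht := by
    have hd : Measurable fun a : ((Fin (t + 1) → X) × (Fin t → Z)) × Z =>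
        p.dens t (fun i => a.1.1 i.castSucc) a.1.2 (a.1.1 (Fin.last t)) a.2 :=
      (p.measurable_dens t ht).comp
        (f := fun a : ((Fin (t + 1) → X) × (Fin t → Z)) × Z =>
          ((fun i : Fin t => a.1.1 i.castSucc), a.1.2, a.1.1 (Fin.last t), a.2)) (by fun_prop)
    have hm : Measurable fun a : (Fin (t + 1) → X) × (Fin t → Z) => p.predictive t a.1 a.2 :=
      hd.coe_nnreal_ennreal.lintegral_prod_right'
    have hm' : Measurable fun a : (Fin (t + 1) → X) × (Fin t → Z) × Z =>
        p.predictive t a.1 a.2.1 :=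
      hm.comp (f := fun a : (Fin (t + 1) → X) × (Fin t → Z) × Z => (a.1, a.2.1)) (by fun_prop)
    have hd' : Measurable fun a : (Fin (t + 1) → X) × (Fin t → Z) × Z =>
        p.dens t (fun i => a.1 i.castSucc) a.2.1 (a.1 (Fin.last t)) a.2.2 :=
      hd.comp (f := fun a : (Fin (t + 1) → X) × (Fin t → Z) × Z => ((a.1, a.2.1), a.2.2))
        (by fun_prop)
    exact Measurable.ite ((hm' (measurableSet_singleton 0)).union
      (hm' (measurableSet_singleton ∞))) (by fun_prop) (hd'.div hm'.ennreal_toNNReal)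
  lintegral_dens t ht xs zs := by
    by_cases h : p.predictive t xs zs = 0 ∨ p.predictive t xs zs = ∞
    · simp only [h, if_true, hρ1]
    · simp only [h, if_false]
      rw [not_or] at h
      have hd : Measurable fun z : Z =>
          p.dens t (fun i => xs i.castSucc) zs (xs (Fin.last t)) z :=
        (p.measurable_dens t ht).comp
          (f := fun z : Z => ((fun i : Fin t => xs i.castSucc), zs, xs (Fin.last t), z))
          (by fun_prop)
      exact lintegral_div_toNNReal_eq_one hd h.1 h.2

theorem SequentialModel.transition_normalized [SigmaFinite μ] (p : SequentialModel ν μ T)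
    {ρ : Z → ℝ≥0} (hρ : Measurable ρ) (hρ1 : ∫⁻ z, (ρ z : ℝ≥0∞) ∂μ = 1) (x : ℕ → X) {t : ℕ}
    {zs : Fin t → Z} {c : ℝ≥0} (hc : c ≠ 0)
    (h : ∫⁻ z, (p.transition x t zs z : ℝ≥0∞) ∂μ = c) (z : Z) :
    p.transition x t zs z = c * (p.normalized ρ hρ hρ1).transition x t zs z := by
  have hpred : p.predictive t (obs x (t + 1)) zs = c := h
  have hdens : (p.normalized ρ hρ hρ1).transition x t zs z = p.transition x t zs z / c := by
    simp only [Proposal.transition, SequentialModel.normalized, hpred, ENNReal.coe_eq_zero, hc,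
      ENNReal.coe_ne_top, or_self, if_false, ENNReal.toNNReal_coe]
    rfl
  rw [hdens, mul_div_cancel₀ _ hc]

theorem SequentialModel.neZero_measure (p : SequentialModel ν μ T) (x : ℕ → X) (hT : 0 < T)
    (z : Fin 0 → Z) : NeZero μ := by
  refine ⟨fun h => ?_⟩
  have h1 := p.lintegral_dens 0 hT (obs x 0) z
  subst h
  simp at h1

theorem HasConstantPrediction.exists_posterior [SigmaFinite μ] {p : SequentialModel ν μ T}
    {x : ℕ → X} {e : ℕ → ℝ≥0} (h : HasConstantPrediction p x e) :
    ∃ q : Proposal X μ T, ∀ t < T, ∀ᵐ z ∂Measure.pi fun _ : Fin t => μ, p.joint x t z ≠ 0 →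
      z ∈ matchSet p q x t (e (t + 1) / e t) := by
  rcases Nat.eq_zero_or_pos T with hT | hT
  · subst hT
    exact ⟨⟨fun _ _ _ _ => 0, fun t ht => absurd ht (by omega), fun t ht => absurd ht (by omega)⟩,
      fun t ht => absurd ht (by omega)⟩
  · have := p.neZero_measure x hT Fin.elim0
    obtain ⟨ρ, hρ, hρ1⟩ := exists_lintegral_eq_one μ
    refine ⟨p.normalized ρ hρ hρ1, fun t ht => ?_⟩
    filter_upwards [h.lintegral_transition t ht] with z hz h0
    exact Filter.Eventually.of_forall (f := ae μ) (p.transition_normalized hρ hρ1 x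
      (div_ne_zero (h.ne_zero _ ht) (h.ne_zero _ ht.le)) (hz h0))

end Existence

/-! ### From equal posteriors to a constant prediction -/

section ConstantPrediction

variable {X Z : Type*} [MeasurableSpace X] [MeasurableSpace Z]
  {ν : Measure X} {μ : Measure Z} {T t : ℕ}

theorem lintegral_joint_concat (p : SequentialModel ν μ T) (x : ℕ → X) (ht : t < T)
    (z : Fin t → Z) : ∫⁻ z', (p.joint x (t + 1) (concat z z') : ℝ≥0∞) ∂μ =
      p.joint x t z * ∫⁻ z', (p.transition x t z z' : ℝ≥0∞) ∂μ := by
  have hp : Measurable fun z' => (p.transition x t z z' : ℝ≥0∞) :=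
    ((p.measurable_transition x ht).comp measurable_prodMk_left).coe_nnreal_ennreal
  simp only [SequentialModel.joint_concat, ENNReal.coe_mul]
  exact lintegral_const_mul _ hp

variable [SigmaFinite μ] {p : SequentialModel ν μ T} {x : ℕ → X}

theorem evidence_succ (p : SequentialModel ν μ T) (x : ℕ → X) (ht : t < T) :
    p.evidence x (t + 1) = ∫⁻ z, ∫⁻ z', (p.joint x (t + 1) (concat z z') : ℝ≥0∞) ∂μ
      ∂Measure.pi fun _ : Fin t => μ :=
  lintegral_pi_succ μ (p.measurable_joint x ht).coe_nnreal_ennreal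

theorem evidence_ne_zero_and_ne_top_of_succ (ht : t < T) (h0 : p.evidence x (t + 1) ≠ 0)
    (h1 : p.evidence x (t + 1) ≠ ∞)
    (hindep : 1 ≤ t → ∀ᵐ z ∂Measure.pi fun _ : Fin t => μ,
      p.lookaheadPosterior x t z = p.posterior x t z) :
    p.evidence x t ≠ 0 ∧ p.evidence x t ≠ ∞ := by
  rcases Nat.eq_zero_or_pos t with rfl | htpos
  · simp [evidence_zero]
  -- Zero evidence at `t` makes the joint density vanish almost everywhere. Infinite evidence makes
  -- the posterior zero, as division by `∞` gives 0; the lookahead posterior is then zero too.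
  -- Either way the evidence at `t + 1` would be zero.
  refine ⟨fun h => h0 ?_, fun h => h0 ?_⟩
  · rw [evidence_succ p x ht]
    rw [SequentialModel.evidence,
      lintegral_eq_zero_iff (p.measurable_joint x ht.le).coe_nnreal_ennreal] at h
    rw [lintegral_congr_ae (g := fun _ => 0), lintegral_zero]
    filter_upwards [h] with z hz
    rw [lintegral_joint_concat p x ht, show (p.joint x t z : ℝ≥0∞) = 0 from hz, zero_mul]
  · rw [evidence_succ p x ht, lintegral_congr_ae (g := fun _ => 0), lintegral_zero]
    filter_upwards [hindep htpos] with z hz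
    rw [SequentialModel.lookaheadPosterior, SequentialModel.posterior, h, ENNReal.div_top,
      ENNReal.div_eq_zero_iff] at hz
    exact hz.resolve_right h1

theorem hasConstantPrediction (hpos : p.evidence x T ≠ 0) (hfin : p.evidence x T ≠ ∞)
    (hindep : ∀ t, 1 ≤ t → t < T → ∀ᵐ z ∂Measure.pi fun _ : Fin t => μ,
      p.lookaheadPosterior x t z = p.posterior x t z) :
    HasConstantPrediction p x fun t => (p.evidence x t).toNNReal := by
  have hev : ∀ t ≤ T, p.evidence x t ≠ 0 ∧ p.evidence x t ≠ ∞ := fun t ht =>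
    Nat.decreasingInduction (motive := fun t _ => p.evidence x t ≠ 0 ∧ p.evidence x t ≠ ∞)
      (fun t ht h => evidence_ne_zero_and_ne_top_of_succ ht h.1 h.2 fun h1 => hindep t h1 ht)
      ⟨hpos, hfin⟩ ht
  have hne : ∀ t ≤ T, (p.evidence x t).toNNReal ≠ 0 := fun t ht =>
    (ENNReal.toNNReal_pos (hev t ht).1 (hev t ht).2).ne'
  refine ⟨fun t ht => (ENNReal.coe_toNNReal (hev t ht).2).symm, hne, fun t ht => ?_⟩
  rw [ENNReal.coe_div (hne t ht.le), ENNReal.coe_toNNReal (hev t ht.le).2,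
    ENNReal.coe_toNNReal (hev (t + 1) ht).2]
  rcases Nat.eq_zero_or_pos t with rfl | htpos
  -- There are no earlier latents at time 0, so the prediction is trivially constant.
  · refine .of_forall fun z _ => ?_
    rw [evidence_zero, div_one, evidence_succ p x ht, lintegral_pi_zero,
      lintegral_joint_concat p x ht, SequentialModel.joint_eq, chainDensity_zero, ENNReal.coe_one,
      one_mul, Subsingleton.elim z Fin.elim0]
  · filter_upwards [hindep t htpos ht] with z hz h0
    have h0' : (p.joint x t z : ℝ≥0∞) ≠ 0 := by exact_mod_cast h0
    obtain ⟨ha, ha'⟩ := hev (t + 1) ht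
    rw [SequentialModel.lookaheadPosterior, SequentialModel.posterior,
      lintegral_joint_concat p x ht, mul_div_assoc, div_eq_mul_inv (p.joint x t z : ℝ≥0∞),
      ENNReal.mul_right_inj h0' ENNReal.coe_ne_top] at hz
    -- After cancelling the joint density, `hz` says that the prediction divided by the evidence at
    -- `t + 1` is the inverse of the evidence at `t`.
    rw [← ENNReal.div_mul_cancel ha ha' (b := ∫⁻ z', (p.transition x t z z' : ℝ≥0∞) ∂μ), hz,
      ENNReal.div_eq_inv_mul]

end ConstantPrediction

/-! ### The maximizers of the objective -/

theorem proposition2 {X Z : Type*} [MeasurableSpace X] [MeasurableSpace Z]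
    (ν : Measure X) (μ : Measure Z) [SigmaFinite ν] [SigmaFinite μ]
    (T N : ℕ) (hN : 0 < N)
    (C : ℕ → Set (Fin N → ℝ≥0)) (hC : ∀ t, MeasurableSet (C t))
    (p : SequentialModel ν μ T) (x : ℕ → X)
    (hpos : 0 < p.evidence x T) (hfin : p.evidence x T < ∞)
    (hindep : ∀ t, 1 ≤ t → t < T → ∀ᵐ z ∂Measure.pi fun _ : Fin t => μ,
      p.lookaheadPosterior x t z = p.posterior x t z) :
    (fivoArgmax C p x).Nonempty ∧
      (∀ q : Proposal X μ T, q ∈ fivoArgmax C p x ↔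
        ∀ᵐ z ∂Measure.pi fun _ : Fin T => μ, (q.joint x z : ℝ≥0∞) = p.posterior x T z) ∧
      ∀ q ∈ fivoArgmax C p x, fivo C p x q = ENNReal.log (p.evidence x T) := by
  have h := hasConstantPrediction hpos.ne' hfin.ne hindep
  have hlog := h.evidence_eq T le_rfl
  obtain ⟨q₀, hq₀⟩ := h.exists_posterior
  have hmax : fivo C p x q₀ = ENNReal.log (p.evidence x T) := by
    rw [hlog, (h.fivo_le hN hC).2]
    exact h.ae_estimate_eq_of_matchSet hN hC hq₀ le_rfl
  have hle : ∀ q, fivo C p x q ≤ ENNReal.log (p.evidence x T) := fun q => by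
    rw [hlog]
    exact (h.fivo_le hN hC).1
  -- Since `q₀` attains the upper bound, being a maximizer means attaining it.
  have hmem : ∀ q, q ∈ fivoArgmax C p x ↔ fivo C p x q = ENNReal.log (p.evidence x T) := fun q =>
    ⟨fun hq => le_antisymm (hle q) (hmax ▸ hq q₀), fun hq q' => hq ▸ hle q'⟩
  refine ⟨⟨q₀, (hmem q₀).2 hmax⟩, fun q => ?_, fun q hq => (hmem q).1 hq⟩
  rw [hmem, hlog, (h.fivo_le hN hC).2, h.ae_estimate_eq_iff hN hC]
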